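/- Let $N\ge 2$ be an integer and let $p,q,a,b,s,m,\delta,\mu$ be real numbers with $$1<p<N,\quad 1<q<N,\quad \min(p+a,\,q+b)>0,\quad \delta,\mu>0,\quad s,m\ge 0,\quad \delta\mu-(p-1-s)(q-1-m)>0 .$$ Consider in $\mathbb{R}^N$ the system $$(S)\qquad -\Delta_p u=|x|^a u^s v^\delta,\qquad -\Delta_q v=|x|^b u^\mu v^m .$$ A positive radial solution of $(S)$ on $(0,R)$, $0<R\le\infty$, is a pair $u,v\in C^2(0,R)$ of positive functions of $r=|x|$ such that on $(0,R)$ $$\left(r^{N-1}|u'|^{p-2}u'\right)'=-r^{N-1+a}u^s v^\delta,\qquad \left(r^{N-1}|v'|^{q-2}v'\right)'=-r^{N-1+b}u^\mu v^m .$$ It is regular (at $0$) if in addition $u,v\in C([0,R))$. A (radial) ground state is a positive radial solution on $(0,\infty)$ that is regular at $0$. For a positive radial solution put, with $t=\ln r$, $$X(t)=-\frac{r u'(r)}{u(r)},\qquad Y(t)=-\frac{r v'(r)}{v(r)} .$$ **Theorem 1.1.** Assume $$s<\frac{N(p-1)+p+pa}{N-p}\qquad\text{and}\qquad m<\frac{N(q-1)+q+qb}{N-q},$$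 and suppose that $(S)$ has no radial ground state. Then: (i) there exist a regular positive radial solution $(u,v)$ of $(S)$ on some interval $(0,R)$, $0<R<\infty$, and a number $T>0$ with $e^T<R$ such that $X(T)=\frac{N-p}{p-1}$ and $Y(T)=\frac{N-q}{q-1}$, while $0<X(t)<\frac{N-p}{p-1}$ and $0<Y(t)<\frac{N-q}{q-1}$ for all $t\in(-\infty,T)$; (ii) there exists a positive radial solution of the Dirichlet problem for $(S)$ in some ball $B(0,R)$, $0<R<\infty$, that is, a positive radial solution $(u,v)$ of $(S)$ on $(0,R)$ with $u,v\in C([0,R])$ and $u(R)=v(R)=0$. -/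

import Mathlib

open Set

/-- The radial flux `r ^ (N - 1) * |u'(r)| ^ (p - 2) * u'(r)`: for a radial function `u(|x|)` on `ℝ ^ N`
one has `Δ_p u = r ^ (1 - N) * (radialFlux N p u)'(r)`, where `r = |x|`. -/
noncomputable def radialFlux (N : ℕ) (p : ℝ) (u : ℝ → ℝ) (r : ℝ) : ℝ :=
  r ^ ((N : ℝ) - 1) * (|deriv u r| ^ (p - 2) * deriv u r)

/-- `(u, v)` is a positive radial solution, of class `C²`, on the open set `I ⊆ (0, ∞)` of radii, of
the system `-Δ_p u = |x|^a u^s v^δ`, `-Δ_q v = |x|^b u^μ v^m` in `ℝ ^ N`. Each equation is multiplied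
by `r ^ (N - 1)`, and differentiability of the flux is part of the requirement. -/
structure IsPositiveRadialSolution (N : ℕ) (p q a b s m δ μ : ℝ) (I : Set ℝ) (u v : ℝ → ℝ) :
    Prop where
  u_pos : ∀ r ∈ I, 0 < u r
  v_pos : ∀ r ∈ I, 0 < v r
  u_contDiffOn : ContDiffOn ℝ 2 u I
  v_contDiffOn : ContDiffOn ℝ 2 v I
  u_equation : ∀ r ∈ I,
    HasDerivAt (radialFlux N p u) (-(r ^ ((N : ℝ) - 1) * (r ^ a * u r ^ s * v r ^ δ))) r
  v_equation : ∀ r ∈ I,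
    HasDerivAt (radialFlux N q v) (-(r ^ ((N : ℝ) - 1) * (r ^ b * u r ^ μ * v r ^ m))) r

/-- A positive radial solution on `(0, R)` that is regular at `0`: it lies in `C²(0, R) ∩ C([0, R))`. -/
structure IsRegularRadialSolution (N : ℕ) (p q a b s m δ μ R : ℝ) (u v : ℝ → ℝ) : Prop where
  isSolution : IsPositiveRadialSolution N p q a b s m δ μ (Ioo 0 R) u v
  u_continuousOn : ContinuousOn u (Ico 0 R)
  v_continuousOn : ContinuousOn v (Ico 0 R)

/-- A (radial) ground state: a positive solution on `(0, ∞)` that is regular at `0`. -/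
structure IsRadialGroundState (N : ℕ) (p q a b s m δ μ : ℝ) (u v : ℝ → ℝ) : Prop where
  isSolution : IsPositiveRadialSolution N p q a b s m δ μ (Ioi 0) u v
  u_continuousOn : ContinuousOn u (Ici 0)
  v_continuousOn : ContinuousOn v (Ici 0)

/-- A positive radial solution of the Dirichlet problem in the ball `B(0, R)`: regular at `0`,
continuous up to the boundary, and zero there. -/
structure IsRadialDirichletSolution (N : ℕ) (p q a b s m δ μ R : ℝ) (u v : ℝ → ℝ) : Prop where
  radius_pos : 0 < R
  isSolution : IsPositiveRadialSolution N p q a b s m δ μ (Ioo 0 R) u v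
  u_continuousOn : ContinuousOn u (Icc 0 R)
  v_continuousOn : ContinuousOn v (Icc 0 R)
  u_boundary : u R = 0
  v_boundary : v R = 0

/-- The phase variable `-r u'(r) / u(r)` at `r = e ^ t`. For a solution `(u, v)` it is `X(t)`; applied
to `v` it is `Y(t)`. -/
noncomputable def phaseSlope (u : ℝ → ℝ) (t : ℝ) : ℝ :=
  -(Real.exp t * deriv u (Real.exp t)) / u (Real.exp t)

/-!
A regular radial solution is determined by its two central values. After rescaling both unknowns to
the value `1` at the origin, the central values enter only through two strengths `c, d ≥ 0`, and the
system becomes a pair of Volterra integral equations, `IsSol`. Rescaling the radius multiplies `c` and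
`d` by powers of the scale with exponents of the same sign, so the segment `c = 1 - θ`, `d = θ` with
`θ ∈ [0, 1]` represents all of them. At the end points the system decouples: for `θ = 0` the second
unknown is constant, and the first one solves a scalar Emden-Fowler equation.

No `θ` gives a solution that is positive for all radii: in the interior this would be a ground state,
and at the end points the subcriticality of `s` and `m` excludes it by the Pohozaev identity
(`not_global_of_subcritical`). The two claims then follow by connectedness of `[0, 1]`. For the first
one, consider the gap `x₀ u + r u'`, with `x₀ = (N - p) / (p - 1)`, which is positive exactly when the
phase variable `-r u' / u` lies below `x₀`. It decreases along solutions (`IsSol.hasDerivAt_gap`), and a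
solution on a maximal bounded interval must have one of its two gaps negative somewhere
(`IsMaximalSol.exists_gap_neg`). The set of `θ` for which the gap of `u` turns negative first and the
set of those for which the gap of `v` does are open, disjoint, and contain `0` and `1` respectively, so
some `θ` lies in neither: there both gaps vanish at the same radius (`exists_simultaneous_crossing`).
The second claim follows in the same way from the sets of `θ` for which `u`, or `v`, vanishes first at
the end of the maximal interval (`exists_simultaneous_zero`).

The powers in the reaction terms need not be Lipschitz at `0`, nor need the power `1 / (p - 1)` of the
flux be. Existence, uniqueness and continuous dependence are therefore proved for the system in which
the unknowns are truncated to `[ε, 1]`. Then all the means that enter are bounded away from `0`, and a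
contraction argument in an exponentially weighted norm applies on every bounded interval, the
singularity at `r = 0` included. On a compact interval a positive solution stays above some `ε`, so the
results carry over.
-/

open Filter MeasureTheory
open scoped Topology

/-! ### Weighted radial means -/

/-- The weighted mean `∫₀¹ σ ^ (A - 1) f (r σ) dσ`, which for `r > 0` equals
`r ^ (-A) ∫₀ʳ σ ^ (A - 1) f σ dσ`. The scaled form has no singularity at `r = 0`. -/
noncomputable def radialMean (A : ℝ) (f : ℝ → ℝ) (r : ℝ) : ℝ :=
  ∫ σ in (0 : ℝ)..1, σ ^ (A - 1) * f (r * σ)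

section RadialMean

variable {A : ℝ} {f g : ℝ → ℝ} {r L B : ℝ}

lemma mul_mem_Icc_of_mem_unit {σ : ℝ} (hr : 0 ≤ r) (hσ : σ ∈ Icc (0 : ℝ) 1) :
    r * σ ∈ Icc 0 r :=
  ⟨mul_nonneg hr hσ.1, mul_le_of_le_one_right hr hσ.2⟩

lemma intervalIntegrable_radialMean (hA : 0 < A) (hr : 0 ≤ r) (hf : ContinuousOn f (Icc 0 r)) :
    IntervalIntegrable (fun σ => σ ^ (A - 1) * f (r * σ)) volume 0 1 := by
  refine (intervalIntegral.intervalIntegrable_rpow' (by linarith)).mul_continuousOn ?_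
  rw [uIcc_of_le zero_le_one]
  exact hf.comp (by fun_prop) fun σ hσ => mul_mem_Icc_of_mem_unit hr hσ

lemma integral_rpow_sub_one (hA : 0 < A) : ∫ σ in (0 : ℝ)..1, σ ^ (A - 1) = A⁻¹ := by
  rw [integral_rpow (Or.inl (by linarith))]
  simp [hA.ne']

lemma radialMean_const (hA : 0 < A) (c r : ℝ) : radialMean A (fun _ => c) r = c / A := by
  unfold radialMean
  rw [intervalIntegral.integral_mul_const, integral_rpow_sub_one hA]
  field_simp

lemma radialMean_congr (hr : 0 ≤ r) (h : EqOn f g (Icc 0 r)) :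
    radialMean A f r = radialMean A g r := by
  refine intervalIntegral.integral_congr fun σ hσ => ?_
  rw [uIcc_of_le zero_le_one] at hσ
  rw [h (mul_mem_Icc_of_mem_unit hr hσ)]

lemma radialMean_mono (hA : 0 < A) (hr : 0 ≤ r) (hf : ContinuousOn f (Icc 0 r))
    (hg : ContinuousOn g (Icc 0 r)) (h : ∀ x ∈ Icc 0 r, f x ≤ g x) :
    radialMean A f r ≤ radialMean A g r :=
  intervalIntegral.integral_mono_on zero_le_one (intervalIntegrable_radialMean hA hr hf)
    (intervalIntegrable_radialMean hA hr hg) fun _ hσ =>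
      mul_le_mul_of_nonneg_left (h _ (mul_mem_Icc_of_mem_unit hr hσ)) (Real.rpow_nonneg hσ.1 _)

lemma radialMean_le (hA : 0 < A) (hr : 0 ≤ r) (hf : ContinuousOn f (Icc 0 r))
    (h : ∀ x ∈ Icc 0 r, f x ≤ B) : radialMean A f r ≤ B / A :=
  radialMean_const hA B r ▸ radialMean_mono hA hr hf continuousOn_const h

lemma le_radialMean (hA : 0 < A) (hr : 0 ≤ r) (hf : ContinuousOn f (Icc 0 r))
    (h : ∀ x ∈ Icc 0 r, B ≤ f x) : B / A ≤ radialMean A f r :=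
  radialMean_const hA B r ▸ radialMean_mono hA hr continuousOn_const hf h

lemma abs_radialMean_sub_le (hA : 0 < A) (hr : 0 ≤ r) (hf : ContinuousOn f (Icc 0 r))
    (hg : ContinuousOn g (Icc 0 r)) (h : ∀ x ∈ Icc 0 r, |f x - g x| ≤ B) :
    |radialMean A f r - radialMean A g r| ≤ B / A := by
  have e : radialMean A f r - radialMean A g r = radialMean A (fun x => f x - g x) r := by
    unfold radialMean
    rw [← intervalIntegral.integral_sub (intervalIntegrable_radialMean hA hr hf)
      (intervalIntegrable_radialMean hA hr hg)]
    simp only [mul_sub]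
  rw [e, abs_le]
  constructor
  · rw [← neg_div]
    exact le_radialMean hA hr (hf.sub hg) fun x hx => (abs_le.1 (h x hx)).1
  · exact radialMean_le hA hr (hf.sub hg) fun x hx => (abs_le.1 (h x hx)).2

lemma continuousOn_radialMean (hA : 0 < A) (hf : ContinuousOn f (Icc 0 L)) :
    ContinuousOn (radialMean A f) (Icc 0 L) := by
  rcases lt_or_ge L 0 with hL | hL
  · simp [Icc_eq_empty_of_lt hL]
  -- Extending `f` by its boundary values makes the integrand globally continuous and bounded.
  set F : ℝ → ℝ := IccExtend hL ((Icc 0 L).domRestrict f) with hF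
  have hFc : Continuous F := hf.domRestrict.Icc_extend'
  obtain ⟨C, hC⟩ := isCompact_Icc.exists_bound_of_continuousOn hf
  have hFb : ∀ x, ‖F x‖ ≤ C := fun x => hC _ (projIcc 0 L hL x).2
  have hcont : Continuous (radialMean A F) := by
    refine continuous_iff_continuousAt.2 fun r => ?_
    refine intervalIntegral.continuousAt_of_dominated_interval
      (bound := fun σ => σ ^ (A - 1) * C) ?_ ?_ ?_ ?_
    · refine Eventually.of_forall fun x => ?_
      exact ((measurable_id.pow_const _).mul
        (hFc.measurable.comp (measurable_const_mul x))).aestronglyMeasurable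
    · refine Eventually.of_forall fun x => Eventually.of_forall fun σ hσ => ?_
      rw [uIoc_of_le zero_le_one] at hσ
      rw [norm_mul, Real.norm_of_nonneg (Real.rpow_nonneg hσ.1.le _)]
      exact mul_le_mul_of_nonneg_left (hFb _) (Real.rpow_nonneg hσ.1.le _)
    · exact (intervalIntegral.intervalIntegrable_rpow' (by linarith)).mul_const C
    · exact Eventually.of_forall fun σ _ => by fun_prop
  refine hcont.continuousOn.congr fun r hr => radialMean_congr hr.1 fun x hx => ?_
  exact (IccExtend_of_mem hL ((Icc 0 L).domRestrict f) ⟨hx.1, hx.2.trans hr.2⟩).symm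

lemma rpow_mul_radialMean (hr : 0 < r) :
    r ^ A * radialMean A f r = ∫ σ in (0 : ℝ)..r, σ ^ (A - 1) * f σ := by
  have h := intervalIntegral.mul_integral_comp_mul_left (a := 0) (b := 1) r
    (f := fun σ => σ ^ (A - 1) * f σ)
  rw [mul_zero, mul_one] at h
  rw [← h, radialMean, ← intervalIntegral.integral_const_mul,
    ← intervalIntegral.integral_const_mul]
  refine intervalIntegral.integral_congr fun σ hσ => ?_
  rw [uIcc_of_le zero_le_one] at hσ
  rw [Real.mul_rpow hr.le hσ.1, Real.rpow_sub_one hr.ne']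
  field_simp

lemma hasDerivAt_integral_rpow_mul (hA : 0 < A) (hf : ContinuousOn f (Icc 0 L))
    (hr : r ∈ Ioo 0 L) :
    HasDerivAt (fun x => ∫ σ in (0 : ℝ)..x, σ ^ (A - 1) * f σ) (r ^ (A - 1) * f r) r := by
  have hc : ContinuousOn (fun σ => σ ^ (A - 1) * f σ) (Ioo 0 L) := by
    refine ContinuousOn.mul (fun x hx => ?_) (hf.mono Ioo_subset_Icc_self)
    exact (Real.continuousAt_rpow_const x _ (Or.inl hx.1.ne')).continuousWithinAt
  refine intervalIntegral.integral_hasDerivAt_right ?_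
    (hc.stronglyMeasurableAtFilter isOpen_Ioo r hr) (hc.continuousAt (Ioo_mem_nhds hr.1 hr.2))
  refine (intervalIntegral.intervalIntegrable_rpow' (by linarith)).mul_continuousOn ?_
  rw [uIcc_of_le hr.1.le]
  exact hf.mono (Icc_subset_Icc_right hr.2.le)

end RadialMean

/-! ### The normalized integral equations -/

/-- The data of one equation of the normalized integral system
`u r = 1 - c ∫₀ʳ τ ^ α (∫₀¹ σ ^ (A - 1) (u ^ s v ^ δ) (τ σ) dσ) ^ κ dτ`.
The equation `-Δ_p u = |x| ^ a u ^ s v ^ δ` in `ℝ ^ N` corresponds to `A = N + a`,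
`α = (1 + a) / (p - 1)` and `κ = 1 / (p - 1)`. The field `s` is the exponent of the unknown that the
equation determines, and `δ` the exponent of the other unknown. -/
structure RadialEqn where
  A : ℝ
  α : ℝ
  κ : ℝ
  s : ℝ
  δ : ℝ
  A_pos : 0 < A
  α_gt : -1 < α
  κ_pos : 0 < κ
  s_nonneg : 0 ≤ s
  δ_nonneg : 0 ≤ δ
  lt_mul : α + 1 < κ * A

/-- On `[0, L]` the functions `u` and `v` are continuous with values in `[ε, 1]`. -/
structure InBand (ε L : ℝ) (u v : ℝ → ℝ) : Prop where
  cont_u : ContinuousOn u (Icc 0 L)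
  cont_v : ContinuousOn v (Icc 0 L)
  mem_u : ∀ x ∈ Icc 0 L, u x ∈ Icc ε 1
  mem_v : ∀ x ∈ Icc 0 L, v x ∈ Icc ε 1

lemma InBand.mono {ε L r : ℝ} {u v : ℝ → ℝ} (h : InBand ε L u v) (hr : r ≤ L) :
    InBand ε r u v where
  cont_u := h.cont_u.mono (Icc_subset_Icc_right hr)
  cont_v := h.cont_v.mono (Icc_subset_Icc_right hr)
  mem_u := fun x hx => h.mem_u x (Icc_subset_Icc_right hr hx)
  mem_v := fun x hx => h.mem_v x (Icc_subset_Icc_right hr hx)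

lemma InBand.symm {ε L : ℝ} {u v : ℝ → ℝ} (h : InBand ε L u v) : InBand ε L v u :=
  ⟨h.cont_v, h.cont_u, h.mem_v, h.mem_u⟩

lemma exists_lipschitz_rpow (e : ℝ) {l M : ℝ} (hl : 0 < l) :
    ∃ K, 0 ≤ K ∧ ∀ x ∈ Icc l M, ∀ y ∈ Icc l M, |x ^ e - y ^ e| ≤ K * |x - y| := by
  have hc : ContinuousOn (fun x : ℝ => e * x ^ (e - 1)) (Icc l M) := fun x hx =>
    ((Real.continuousAt_rpow_const x _ (Or.inl (hl.trans_le hx.1).ne')).const_mul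
      e).continuousWithinAt
  obtain ⟨C, hC⟩ := isCompact_Icc.exists_bound_of_continuousOn hc
  refine ⟨max C 0, le_max_right _ _, fun x hx y hy => ?_⟩
  exact (convex_Icc l M).norm_image_sub_le_of_norm_hasDerivWithin_le
    (fun z hz => (Real.hasDerivAt_rpow_const
      (Or.inl (hl.trans_le hz.1).ne')).hasDerivWithinAt)
    (fun z hz => (hC z hz).trans (le_max_left _ _)) hy hx

namespace RadialEqn

variable (E F : RadialEqn) {ε L r : ℝ} {u v u' v' : ℝ → ℝ}

/-- The reaction term `u ^ s v ^ δ`. -/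
noncomputable def force (u v : ℝ → ℝ) (x : ℝ) : ℝ := u x ^ E.s * v x ^ E.δ

/-- The mean of the reaction term over the ball of radius `r`, with the weight of the equation. -/
noncomputable def mean (u v : ℝ → ℝ) (r : ℝ) : ℝ := radialMean E.A (E.force u v) r

/-- The total decay `∫₀ʳ τ ^ α (mean τ) ^ κ dτ` that the reaction causes, at unit strength. -/
noncomputable def decay (u v : ℝ → ℝ) (r : ℝ) : ℝ :=
  ∫ τ in (0 : ℝ)..r, τ ^ E.α * E.mean u v τ ^ E.κ

lemma mean_congr (hr : 0 ≤ r) (hu : EqOn u u' (Icc 0 r)) (hv : EqOn v v' (Icc 0 r)) :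
    E.mean u v r = E.mean u' v' r :=
  radialMean_congr hr fun x hx => by simp only [force, hu hx, hv hx]

lemma decay_congr (hr : 0 ≤ r) (hu : EqOn u u' (Icc 0 r)) (hv : EqOn v v' (Icc 0 r)) :
    E.decay u v r = E.decay u' v' r := by
  refine intervalIntegral.integral_congr fun τ hτ => ?_
  rw [uIcc_of_le hr] at hτ
  rw [E.mean_congr hτ.1 (hu.mono (Icc_subset_Icc_right hτ.2))
    (hv.mono (Icc_subset_Icc_right hτ.2))]

lemma decay_zero : E.decay u v 0 = 0 := by simp [decay]

lemma continuousOn_force (hu : ContinuousOn u (Icc 0 L)) (hv : ContinuousOn v (Icc 0 L)) :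
    ContinuousOn (E.force u v) (Icc 0 L) :=
  (hu.rpow_const fun _ _ => Or.inr E.s_nonneg).mul (hv.rpow_const fun _ _ => Or.inr E.δ_nonneg)

lemma continuousOn_mean (hu : ContinuousOn u (Icc 0 L)) (hv : ContinuousOn v (Icc 0 L)) :
    ContinuousOn (E.mean u v) (Icc 0 L) :=
  continuousOn_radialMean E.A_pos (E.continuousOn_force hu hv)

lemma continuousOn_mean_rpow (hu : ContinuousOn u (Icc 0 L)) (hv : ContinuousOn v (Icc 0 L)) :
    ContinuousOn (fun r => E.mean u v r ^ E.κ) (Icc 0 L) :=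
  (E.continuousOn_mean hu hv).rpow_const fun _ _ => Or.inr E.κ_pos.le

lemma intervalIntegrable_rpow_mul {f : ℝ → ℝ} (hr : 0 ≤ r) (hf : ContinuousOn f (Icc 0 r)) :
    IntervalIntegrable (fun τ => τ ^ E.α * f τ) volume 0 r :=
  (intervalIntegral.intervalIntegrable_rpow' E.α_gt).mul_continuousOn (by rwa [uIcc_of_le hr])

lemma continuousOn_decay (hu : ContinuousOn u (Icc 0 L)) (hv : ContinuousOn v (Icc 0 L)) :
    ContinuousOn (E.decay u v) (Icc 0 L) := by
  rcases lt_or_ge L 0 with hL | hL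
  · simp [Icc_eq_empty_of_lt hL]
  have h := E.intervalIntegrable_rpow_mul hL (E.continuousOn_mean_rpow hu hv)
  have := intervalIntegral.continuousOn_primitive_interval' h left_mem_uIcc
  rwa [uIcc_of_le hL] at this

lemma hasDerivAt_decay (hu : ContinuousOn u (Icc 0 L)) (hv : ContinuousOn v (Icc 0 L))
    (hr : r ∈ Ioo 0 L) : HasDerivAt (E.decay u v) (r ^ E.α * E.mean u v r ^ E.κ) r := by
  have hm := E.continuousOn_mean_rpow hu hv
  have hc : ContinuousOn (fun τ => τ ^ E.α * E.mean u v τ ^ E.κ) (Ioo 0 L) := by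
    refine ContinuousOn.mul (fun x hx => ?_) (hm.mono Ioo_subset_Icc_self)
    exact (Real.continuousAt_rpow_const x _ (Or.inl hx.1.ne')).continuousWithinAt
  exact intervalIntegral.integral_hasDerivAt_right
    (E.intervalIntegrable_rpow_mul hr.1.le (hm.mono (Icc_subset_Icc_right hr.2.le)))
    (hc.stronglyMeasurableAtFilter isOpen_Ioo r hr) (hc.continuousAt (Ioo_mem_nhds hr.1 hr.2))

lemma force_nonneg {x : ℝ} (hu : 0 ≤ u x) (hv : 0 ≤ v x) : 0 ≤ E.force u v x :=
  mul_nonneg (Real.rpow_nonneg hu _) (Real.rpow_nonneg hv _)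

lemma force_pos {x : ℝ} (hu : 0 < u x) (hv : 0 < v x) : 0 < E.force u v x :=
  mul_pos (Real.rpow_pos_of_pos hu _) (Real.rpow_pos_of_pos hv _)

lemma force_le_one {x : ℝ} (hu : 0 ≤ u x) (hv : 0 ≤ v x) (hu1 : u x ≤ 1) (hv1 : v x ≤ 1) :
    E.force u v x ≤ 1 :=
  mul_le_one₀ (Real.rpow_le_one hu hu1 E.s_nonneg) (Real.rpow_nonneg hv _)
    (Real.rpow_le_one hv hv1 E.δ_nonneg)

lemma le_force (hε : 0 < ε) {x : ℝ} (hu : ε ≤ u x) (hv : ε ≤ v x) :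
    ε ^ E.s * ε ^ E.δ ≤ E.force u v x :=
  mul_le_mul (Real.rpow_le_rpow hε.le hu E.s_nonneg) (Real.rpow_le_rpow hε.le hv E.δ_nonneg)
    (Real.rpow_nonneg hε.le _) (Real.rpow_nonneg (hε.le.trans hu) _)

lemma mean_nonneg (hr : 0 ≤ r) (hu : ContinuousOn u (Icc 0 r)) (hv : ContinuousOn v (Icc 0 r))
    (hu0 : ∀ x ∈ Icc 0 r, 0 ≤ u x) (hv0 : ∀ x ∈ Icc 0 r, 0 ≤ v x) : 0 ≤ E.mean u v r := by
  have := le_radialMean (B := 0) E.A_pos hr (E.continuousOn_force hu hv) fun x hx =>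
    E.force_nonneg (hu0 x hx) (hv0 x hx)
  rwa [zero_div] at this

lemma mean_mem (hε : 0 < ε) (hr : 0 ≤ r) (h : InBand ε r u v) :
    E.mean u v r ∈ Icc (ε ^ E.s * ε ^ E.δ / E.A) (1 / E.A) :=
  ⟨le_radialMean E.A_pos hr (E.continuousOn_force h.cont_u h.cont_v) fun x hx =>
      E.le_force hε (h.mem_u x hx).1 (h.mem_v x hx).1,
    radialMean_le E.A_pos hr (E.continuousOn_force h.cont_u h.cont_v) fun x hx =>
      E.force_le_one (hε.le.trans (h.mem_u x hx).1) (hε.le.trans (h.mem_v x hx).1)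
        (h.mem_u x hx).2 (h.mem_v x hx).2⟩

/-- Bounded away from `0`, the reaction term is Lipschitz in the unknowns, and so is the power `κ` of
its mean, even where `κ < 1`: the mean itself stays away from `0`. -/
lemma exists_lipschitz_mean_rpow (hε : 0 < ε) :
    ∃ K, 0 ≤ K ∧ ∀ (r : ℝ) (u v u' v' : ℝ → ℝ) (B : ℝ), 0 ≤ r → InBand ε r u v →
      InBand ε r u' v' → (∀ x ∈ Icc 0 r, |u x - u' x| ≤ B) → (∀ x ∈ Icc 0 r, |v x - v' x| ≤ B) →
      |E.mean u v r ^ E.κ - E.mean u' v' r ^ E.κ| ≤ K * B := by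
  obtain ⟨K₁, hK₁, h₁⟩ := exists_lipschitz_rpow E.s (M := 1) hε
  obtain ⟨K₂, hK₂, h₂⟩ := exists_lipschitz_rpow E.δ (M := 1) hε
  have hl : 0 < ε ^ E.s * ε ^ E.δ / E.A := div_pos
    (mul_pos (Real.rpow_pos_of_pos hε _) (Real.rpow_pos_of_pos hε _)) E.A_pos
  obtain ⟨K₃, hK₃, h₃⟩ := exists_lipschitz_rpow E.κ (M := 1 / E.A) hl
  refine ⟨K₃ * ((K₁ + K₂) / E.A), mul_nonneg hK₃ (div_nonneg (add_nonneg hK₁ hK₂) E.A_pos.le),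
    fun r u v u' v' B hr h h' hu hv => ?_⟩
  have hforce : ∀ x ∈ Icc 0 r, |E.force u v x - E.force u' v' x| ≤ (K₁ + K₂) * B := by
    intro x hx
    have e : E.force u v x - E.force u' v' x
        = (u x ^ E.s - u' x ^ E.s) * v x ^ E.δ + u' x ^ E.s * (v x ^ E.δ - v' x ^ E.δ) := by
      simp only [force]; ring
    have a₁ : |u x ^ E.s - u' x ^ E.s| ≤ K₁ * B :=
      (h₁ _ (h.mem_u x hx) _ (h'.mem_u x hx)).trans (mul_le_mul_of_nonneg_left (hu x hx) hK₁)
    have a₂ : |v x ^ E.δ - v' x ^ E.δ| ≤ K₂ * B :=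
      (h₂ _ (h.mem_v x hx) _ (h'.mem_v x hx)).trans (mul_le_mul_of_nonneg_left (hv x hx) hK₂)
    have b₁ : |v x ^ E.δ| ≤ 1 := by
      have := hε.le.trans (h.mem_v x hx).1
      rw [abs_of_nonneg (Real.rpow_nonneg this _)]
      exact Real.rpow_le_one this (h.mem_v x hx).2 E.δ_nonneg
    have b₂ : |u' x ^ E.s| ≤ 1 := by
      have := hε.le.trans (h'.mem_u x hx).1
      rw [abs_of_nonneg (Real.rpow_nonneg this _)]
      exact Real.rpow_le_one this (h'.mem_u x hx).2 E.s_nonneg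
    rw [e]
    refine (abs_add_le _ _).trans ?_
    rw [abs_mul, abs_mul, add_mul]
    exact add_le_add ((mul_le_of_le_one_right (abs_nonneg _) b₁).trans a₁)
      ((mul_le_of_le_one_left (abs_nonneg _) b₂).trans a₂)
  have hmean := abs_radialMean_sub_le E.A_pos hr (E.continuousOn_force h.cont_u h.cont_v)
    (E.continuousOn_force h'.cont_u h'.cont_v) hforce
  refine (h₃ _ (E.mean_mem hε hr h) _ (E.mean_mem hε hr h')).trans ?_
  rw [mul_assoc]
  refine mul_le_mul_of_nonneg_left (hmean.trans_eq ?_) hK₃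
  ring

/-- The Volterra estimate: a difference of size `B Λ` in the unknowns changes the decay by at most
`K B Λ / lam`, provided that the weight `Λ` grows so fast that `lam ∫₀ʳ τ ^ α Λ ≤ Λ r`. -/
lemma exists_lipschitz_decay (hε : 0 < ε) :
    ∃ K, 0 ≤ K ∧ ∀ (L : ℝ) (u v u' v' : ℝ → ℝ) (B lam : ℝ) (Λ : ℝ → ℝ), 0 ≤ B → 0 < lam →
      InBand ε L u v → InBand ε L u' v' → ContinuousOn Λ (Icc 0 L) → MonotoneOn Λ (Icc 0 L) →
      (∀ r ∈ Icc 0 L, lam * ∫ τ in (0 : ℝ)..r, τ ^ E.α * Λ τ ≤ Λ r) →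
      (∀ x ∈ Icc 0 L, |u x - u' x| ≤ B * Λ x) → (∀ x ∈ Icc 0 L, |v x - v' x| ≤ B * Λ x) →
      ∀ r ∈ Icc 0 L, |E.decay u v r - E.decay u' v' r| ≤ K * B / lam * Λ r := by
  obtain ⟨K, hK, hLip⟩ := E.exists_lipschitz_mean_rpow hε
  refine ⟨K, hK, fun L u v u' v' B lam Λ hB hlam h h' hΛc hΛm hΛ hu hv r hr => ?_⟩
  have hI {w z : ℝ → ℝ} (H : InBand ε L w z) :=
    E.intervalIntegrable_rpow_mul hr.1 (E.continuousOn_mean_rpow (H.mono hr.2).cont_u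
      (H.mono hr.2).cont_v)
  have hbound : ∀ τ ∈ Icc 0 r,
      |E.mean u v τ ^ E.κ - E.mean u' v' τ ^ E.κ| ≤ K * (B * Λ τ) := fun τ hτ => by
    have hτL := hτ.2.trans hr.2
    have hΛτ : ∀ x ∈ Icc 0 τ, B * Λ x ≤ B * Λ τ := fun x hx => mul_le_mul_of_nonneg_left
      (hΛm ⟨hx.1, hx.2.trans hτL⟩ ⟨hτ.1, hτL⟩ hx.2) hB
    exact hLip τ u v u' v' _ hτ.1 (h.mono hτL) (h'.mono hτL)
      (fun x hx => (hu x ⟨hx.1, hx.2.trans hτL⟩).trans (hΛτ x hx))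
      (fun x hx => (hv x ⟨hx.1, hx.2.trans hτL⟩).trans (hΛτ x hx))
  have hΛI := (E.intervalIntegrable_rpow_mul hr.1 (hΛc.mono (Icc_subset_Icc_right hr.2))).const_mul
    (K * B)
  unfold decay
  rw [← intervalIntegral.integral_sub (hI h) (hI h'), ← Real.norm_eq_abs]
  calc _ ≤ ∫ τ in (0 : ℝ)..r, K * B * (τ ^ E.α * Λ τ) := by
        refine intervalIntegral.norm_integral_le_of_norm_le hr.1 (Eventually.of_forall
          fun τ hτ => ?_) hΛI
        have h0 := Real.rpow_nonneg hτ.1.le E.α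
        rw [← mul_sub, norm_mul, Real.norm_of_nonneg h0, Real.norm_eq_abs]
        calc _ ≤ τ ^ E.α * (K * (B * Λ τ)) :=
              mul_le_mul_of_nonneg_left (hbound τ ⟨hτ.1.le, hτ.2⟩) h0
          _ = _ := by ring
    _ = K * B / lam * (lam * ∫ τ in (0 : ℝ)..r, τ ^ E.α * Λ τ) := by
        rw [intervalIntegral.integral_const_mul]; field_simp
    _ ≤ _ := mul_le_mul_of_nonneg_left (hΛ r hr) (by positivity)

end RadialEqn

/-- The exponential weight whose logarithmic derivative is `lam (r ^ α + r ^ β)`. -/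
noncomputable def growthWeight (lam α β r : ℝ) : ℝ :=
  Real.exp (lam * (r ^ (α + 1) / (α + 1) + r ^ (β + 1) / (β + 1)))

section GrowthWeight

variable {lam α β r : ℝ}

lemma growthWeight_comm (lam α β : ℝ) : growthWeight lam α β = growthWeight lam β α := by
  funext r; simp only [growthWeight, add_comm]

lemma growthWeight_pos (lam α β r : ℝ) : 0 < growthWeight lam α β r := Real.exp_pos _

lemma continuous_growthWeight (hα : -1 < α) (hβ : -1 < β) :
    Continuous (growthWeight lam α β) := by
  have h₁ := Real.continuous_rpow_const (q := α + 1) (by linarith)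
  have h₂ := Real.continuous_rpow_const (q := β + 1) (by linarith)
  unfold growthWeight
  fun_prop

lemma monotoneOn_growthWeight (hlam : 0 ≤ lam) (hα : -1 < α) (hβ : -1 < β) :
    MonotoneOn (growthWeight lam α β) (Ici 0) := by
  intro x hx y _ hxy
  have h1 : 0 < α + 1 := by linarith
  have h2 : 0 < β + 1 := by linarith
  refine Real.exp_le_exp.2 (mul_le_mul_of_nonneg_left (add_le_add ?_ ?_) hlam)
  · exact div_le_div_of_nonneg_right (Real.rpow_le_rpow hx hxy h1.le) h1.le
  · exact div_le_div_of_nonneg_right (Real.rpow_le_rpow hx hxy h2.le) h2.le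

lemma one_le_growthWeight (hlam : 0 ≤ lam) (hα : -1 < α) (hβ : -1 < β) (hr : 0 ≤ r) :
    1 ≤ growthWeight lam α β r := by
  have h1 : 0 < α + 1 := by linarith
  have h2 : 0 < β + 1 := by linarith
  refine Real.one_le_exp (mul_nonneg hlam (add_nonneg ?_ ?_))
  · exact div_nonneg (Real.rpow_nonneg hr _) h1.le
  · exact div_nonneg (Real.rpow_nonneg hr _) h2.le

lemma mul_integral_growthWeight_le (hlam : 0 < lam) (hα : -1 < α) (hβ : -1 < β) (hr : 0 ≤ r) :
    lam * ∫ τ in (0 : ℝ)..r, τ ^ α * growthWeight lam α β τ ≤ growthWeight lam α β r := by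
  have h1 : α + 1 ≠ 0 := by linarith
  have h2 : β + 1 ≠ 0 := by linarith
  have hc := continuous_growthWeight (lam := lam) hα hβ
  have hd : ∀ x ∈ Ioo 0 r, HasDerivAt (growthWeight lam α β)
      (lam * (x ^ α * growthWeight lam α β x) + lam * (x ^ β * growthWeight lam α β x)) x := by
    intro x hx
    have e1 := (Real.hasDerivAt_rpow_const (p := α + 1) (Or.inl hx.1.ne')).div_const (α + 1)
    have e2 := (Real.hasDerivAt_rpow_const (p := β + 1) (Or.inl hx.1.ne')).div_const (β + 1)
    rw [add_sub_cancel_right, mul_div_cancel_left₀ _ h1] at e1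
    rw [add_sub_cancel_right, mul_div_cancel_left₀ _ h2] at e2
    refine ((e1.add e2).const_mul lam).exp.congr_deriv ?_
    simp only [growthWeight, Pi.add_apply]
    ring
  have hI {γ : ℝ} (hγ : -1 < γ) :
      IntervalIntegrable (fun τ => lam * (τ ^ γ * growthWeight lam α β τ)) volume 0 r :=
    ((intervalIntegral.intervalIntegrable_rpow' hγ).mul_continuousOn hc.continuousOn).const_mul lam
  have hftc := intervalIntegral.integral_eq_sub_of_hasDerivAt_of_le hr hc.continuousOn hd
    ((hI hα).add (hI hβ))
  rw [intervalIntegral.integral_add (hI hα) (hI hβ), intervalIntegral.integral_const_mul] at hftc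
  have hpos : 0 ≤ ∫ τ in (0 : ℝ)..r, lam * (τ ^ β * growthWeight lam α β τ) :=
    intervalIntegral.integral_nonneg hr fun τ hτ => mul_nonneg hlam.le
      (mul_nonneg (Real.rpow_nonneg hτ.1 _) (growthWeight_pos ..).le)
  have := growthWeight_pos lam α β 0
  linarith

end GrowthWeight

/-! ### The clamped system -/

/-- Truncation of a real number to the interval `[ε, 1]`. -/
noncomputable def clampUnit (ε x : ℝ) : ℝ := max ε (min x 1)

section ClampUnit

variable {ε x y : ℝ}

lemma clampUnit_mem (hε : ε ≤ 1) (x : ℝ) : clampUnit ε x ∈ Icc ε 1 :=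
  ⟨le_max_left _ _, max_le hε (min_le_right _ _)⟩

lemma clampUnit_of_mem (hx : x ∈ Icc ε 1) : clampUnit ε x = x := by
  rw [clampUnit, min_eq_left hx.2, max_eq_right hx.1]

lemma abs_clampUnit_sub_le (ε x y : ℝ) : |clampUnit ε x - clampUnit ε y| ≤ |x - y| := by
  rw [clampUnit, clampUnit, max_comm ε, max_comm ε]
  refine (abs_max_sub_max_le_abs _ _ _).trans ?_
  exact (abs_min_sub_min_le_max _ _ _ _).trans (by simp)

lemma continuous_clampUnit (ε : ℝ) : Continuous (clampUnit ε) := by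
  unfold clampUnit; fun_prop

end ClampUnit

/-- The normalized integral system on `[0, L]` with strengths `c`, `d`, in which the reaction terms see
only the values of the unknowns truncated to `[ε, 1]`. -/
structure IsClampedSol (E F : RadialEqn) (ε c d L : ℝ) (u v : ℝ → ℝ) : Prop where
  cont_u : ContinuousOn u (Icc 0 L)
  cont_v : ContinuousOn v (Icc 0 L)
  eq_u : ∀ r ∈ Icc 0 L,
    u r = 1 - c * E.decay (fun x => clampUnit ε (u x)) (fun x => clampUnit ε (v x)) r
  eq_v : ∀ r ∈ Icc 0 L,
    v r = 1 - d * F.decay (fun x => clampUnit ε (v x)) (fun x => clampUnit ε (u x)) r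

section Clamped

variable {E F : RadialEqn} {ε c d c' d' L r : ℝ} {u v u' v' : ℝ → ℝ}

lemma inBand_clampUnit (hε : ε ≤ 1) (hu : ContinuousOn u (Icc 0 L))
    (hv : ContinuousOn v (Icc 0 L)) :
    InBand ε L (fun x => clampUnit ε (u x)) (fun x => clampUnit ε (v x)) where
  cont_u := (continuous_clampUnit ε).comp_continuousOn hu
  cont_v := (continuous_clampUnit ε).comp_continuousOn hv
  mem_u := fun _ _ => clampUnit_mem hε _
  mem_v := fun _ _ => clampUnit_mem hε _

lemma IsClampedSol.mono (h : IsClampedSol E F ε c d L u v) (hr : r ≤ L) :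
    IsClampedSol E F ε c d r u v where
  cont_u := h.cont_u.mono (Icc_subset_Icc_right hr)
  cont_v := h.cont_v.mono (Icc_subset_Icc_right hr)
  eq_u := fun x hx => h.eq_u x (Icc_subset_Icc_right hr hx)
  eq_v := fun x hx => h.eq_v x (Icc_subset_Icc_right hr hx)

lemma RadialEqn.abs_decay_le (E : RadialEqn) (hε : 0 < ε) (h : InBand ε L u v)
    (hr : r ∈ Icc 0 L) : |E.decay u v r| ≤ (1 / E.A) ^ E.κ * (L ^ (E.α + 1) / (E.α + 1)) := by
  have hα : 0 < E.α + 1 := by linarith [E.α_gt]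
  have hI : ∫ τ in (0 : ℝ)..r, (1 / E.A) ^ E.κ * τ ^ E.α
      = (1 / E.A) ^ E.κ * (r ^ (E.α + 1) / (E.α + 1)) := by
    rw [intervalIntegral.integral_const_mul, integral_rpow (Or.inl E.α_gt),
      Real.zero_rpow hα.ne', sub_zero]
  have hA : 0 ≤ (1 / E.A) ^ E.κ := Real.rpow_nonneg (one_div_nonneg.2 E.A_pos.le) _
  refine le_trans ?_ (mul_le_mul_of_nonneg_left (div_le_div_of_nonneg_right
    (Real.rpow_le_rpow hr.1 hr.2 hα.le) hα.le) hA)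
  rw [← hI, RadialEqn.decay, ← Real.norm_eq_abs]
  refine intervalIntegral.norm_integral_le_of_norm_le hr.1 (Eventually.of_forall fun τ hτ => ?_)
    ((intervalIntegral.intervalIntegrable_rpow' E.α_gt).const_mul _)
  have hm := E.mean_mem hε hτ.1.le (h.mono (hτ.2.trans hr.2))
  have hm0 : 0 ≤ E.mean u v τ := le_trans (div_nonneg (mul_nonneg (Real.rpow_nonneg hε.le _)
    (Real.rpow_nonneg hε.le _)) E.A_pos.le) hm.1
  rw [norm_mul, Real.norm_of_nonneg (Real.rpow_nonneg hτ.1.le _),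
    Real.norm_of_nonneg (Real.rpow_nonneg hm0 _), mul_comm]
  exact mul_le_mul_of_nonneg_right (Real.rpow_le_rpow hm0 hm.2 E.κ_pos.le)
    (Real.rpow_nonneg hτ.1.le _)

/-- The clamped system is solvable on every interval `[0, L]`: divided by an exponential weight, its
right-hand side is a contraction. -/
lemma exists_isClampedSol (E F : RadialEqn) (hε : 0 < ε) (hε1 : ε ≤ 1) (hc : 0 ≤ c) (hd : 0 ≤ d)
    (hL : 0 ≤ L) : ∃ u v, IsClampedSol E F ε c d L u v := by
  obtain ⟨K₁, hK₁, hLip₁⟩ := E.exists_lipschitz_decay hε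
  obtain ⟨K₂, hK₂, hLip₂⟩ := F.exists_lipschitz_decay hε
  set lam : ℝ := 2 * (c * K₁ + d * K₂) + 1 with hlam_def
  have hlam : 0 < lam := by positivity
  set Λ : ℝ → ℝ := growthWeight lam E.α F.α with hΛ_def
  have hΛpos : ∀ x, 0 < Λ x := growthWeight_pos _ _ _
  have hΛc : Continuous Λ := continuous_growthWeight E.α_gt F.α_gt
  have hΛm : MonotoneOn Λ (Icc 0 L) :=
    (monotoneOn_growthWeight hlam.le E.α_gt F.α_gt).mono Icc_subset_Ici_self
  have hΛ₁ : ∀ r ∈ Icc 0 L, lam * ∫ τ in (0 : ℝ)..r, τ ^ E.α * Λ τ ≤ Λ r := fun r hr =>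
    mul_integral_growthWeight_le hlam E.α_gt F.α_gt hr.1
  have hΛ₂ : ∀ r ∈ Icc 0 L, lam * ∫ τ in (0 : ℝ)..r, τ ^ F.α * Λ τ ≤ Λ r := fun r hr => by
    rw [hΛ_def, growthWeight_comm]
    exact mul_integral_growthWeight_le hlam F.α_gt E.α_gt hr.1
  let U : C(Icc 0 L, ℝ × ℝ) → ℝ → ℝ := fun z x => Λ x * (IccExtend hL z x).1
  let V : C(Icc 0 L, ℝ × ℝ) → ℝ → ℝ := fun z x => Λ x * (IccExtend hL z x).2
  have hU : ∀ z, Continuous (U z) := fun z =>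
    hΛc.mul (continuous_fst.comp z.continuous.Icc_extend')
  have hV : ∀ z, Continuous (V z) := fun z =>
    hΛc.mul (continuous_snd.comp z.continuous.Icc_extend')
  have hband : ∀ z, InBand ε L (fun x => clampUnit ε (U z x)) (fun x => clampUnit ε (V z x)) :=
    fun z => inBand_clampUnit hε1 (hU z).continuousOn (hV z).continuousOn
  let T₁ : C(Icc 0 L, ℝ × ℝ) → ℝ → ℝ := fun z r =>
    (1 - c * E.decay (fun x => clampUnit ε (U z x)) (fun x => clampUnit ε (V z x)) r) / Λ r
  let T₂ : C(Icc 0 L, ℝ × ℝ) → ℝ → ℝ := fun z r =>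
    (1 - d * F.decay (fun x => clampUnit ε (V z x)) (fun x => clampUnit ε (U z x)) r) / Λ r
  have hT₁ : ∀ z, ContinuousOn (T₁ z) (Icc 0 L) := fun z =>
    (continuousOn_const.sub (continuousOn_const.mul
      (E.continuousOn_decay (hband z).cont_u (hband z).cont_v))).div hΛc.continuousOn
      fun x _ => (hΛpos x).ne'
  have hT₂ : ∀ z, ContinuousOn (T₂ z) (Icc 0 L) := fun z =>
    (continuousOn_const.sub (continuousOn_const.mul
      (F.continuousOn_decay (hband z).cont_v (hband z).cont_u))).div hΛc.continuousOn
      fun x _ => (hΛpos x).ne'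
  let T : C(Icc 0 L, ℝ × ℝ) → C(Icc 0 L, ℝ × ℝ) := fun z =>
    ⟨fun r => (T₁ z r, T₂ z r),
      (continuousOn_iff_continuous_domRestrict.1 (hT₁ z)).prodMk
        (continuousOn_iff_continuous_domRestrict.1 (hT₂ z))⟩
  have hdist : ∀ z w x, |U z x - U w x| ≤ dist z w * Λ x ∧ |V z x - V w x| ≤ dist z w * Λ x := by
    intro z w x
    have h := ContinuousMap.dist_apply_le_dist (f := z) (g := w) (projIcc 0 L hL x)
    rw [Prod.dist_eq, max_le_iff, Real.dist_eq, Real.dist_eq] at h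
    have e : ∀ a b : ℝ, |Λ x * a - Λ x * b| = |a - b| * Λ x := fun a b => by
      rw [← mul_sub, abs_mul, abs_of_pos (hΛpos x), mul_comm]
    simp only [U, V, e]
    exact ⟨mul_le_mul_of_nonneg_right h.1 (hΛpos x).le,
      mul_le_mul_of_nonneg_right h.2 (hΛpos x).le⟩
  have hfinal : ∀ {e K D D' B x : ℝ}, 0 ≤ e → 0 ≤ B → e * K ≤ lam / 2 →
      |D - D'| ≤ K * B / lam * Λ x →
      |(1 - e * D) / Λ x - (1 - e * D') / Λ x| ≤ 1 / 2 * B := by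
    intro e K D D' B x he hB hle h
    rw [← sub_div, abs_div, abs_of_pos (hΛpos x), div_le_iff₀ (hΛpos x)]
    have e1 : (1 - e * D) - (1 - e * D') = e * (D' - D) := by ring
    rw [e1, abs_mul, abs_of_nonneg he, abs_sub_comm]
    calc e * |D - D'| ≤ e * (K * B / lam * Λ x) := mul_le_mul_of_nonneg_left h he
      _ = e * K / lam * B * Λ x := by ring
      _ ≤ 1 / 2 * B * Λ x := by
        refine mul_le_mul_of_nonneg_right (mul_le_mul_of_nonneg_right ?_ hB) (hΛpos x).le
        rw [div_le_iff₀ hlam]; linarith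
  have hcK : c * K₁ ≤ lam / 2 := by rw [hlam_def]; nlinarith [mul_nonneg hd hK₂]
  have hdK : d * K₂ ≤ lam / 2 := by rw [hlam_def]; nlinarith [mul_nonneg hc hK₁]
  have hT : ContractingWith (1 / 2) T := by
    refine ⟨by rw [← NNReal.coe_lt_coe]; norm_num, LipschitzWith.of_dist_le_mul fun z w => ?_⟩
    have hB : 0 ≤ dist z w := dist_nonneg
    rw [ContinuousMap.dist_le (by positivity)]
    intro x
    have hu : ∀ x ∈ Icc 0 L, |clampUnit ε (U z x) - clampUnit ε (U w x)| ≤ dist z w * Λ x :=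
      fun x _ => (abs_clampUnit_sub_le _ _ _).trans (hdist z w x).1
    have hv : ∀ x ∈ Icc 0 L, |clampUnit ε (V z x) - clampUnit ε (V w x)| ≤ dist z w * Λ x :=
      fun x _ => (abs_clampUnit_sub_le _ _ _).trans (hdist z w x).2
    rw [Prod.dist_eq, Real.dist_eq, Real.dist_eq]
    have e : ((1 / 2 : NNReal) : ℝ) = 1 / 2 := by norm_num
    rw [e]
    exact max_le
      (hfinal hc hB hcK (hLip₁ L _ _ _ _ _ lam Λ hB hlam (hband z) (hband w) hΛc.continuousOn hΛm
        hΛ₁ hu hv x x.2))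
      (hfinal hd hB hdK (hLip₂ L _ _ _ _ _ lam Λ hB hlam (hband z).symm (hband w).symm
        hΛc.continuousOn hΛm hΛ₂ hv hu x x.2))
  have : Nonempty C(Icc 0 L, ℝ × ℝ) := ⟨ContinuousMap.const _ 0⟩
  set z := hT.fixedPoint T with hz_def
  have hz : T z = z := hT.fixedPoint_isFixedPt
  have hval : ∀ r (hr : r ∈ Icc 0 L), IccExtend hL z r = (T₁ z r, T₂ z r) := fun r hr => by
    rw [IccExtend_of_mem hL _ hr]
    conv_lhs => rw [← hz]
    rfl
  refine ⟨U z, V z, (hU z).continuousOn, (hV z).continuousOn, fun r hr => ?_, fun r hr => ?_⟩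
  · change Λ r * (IccExtend hL z r).1 = _
    rw [hval r hr]
    exact mul_div_cancel₀ _ (hΛpos r).ne'
  · change Λ r * (IccExtend hL z r).2 = _
    rw [hval r hr]
    exact mul_div_cancel₀ _ (hΛpos r).ne'

/-- Solutions of the clamped system depend on the strengths in a Lipschitz way. -/
lemma exists_isClampedSol_lipschitz (E F : RadialEqn) (hε : 0 < ε) (hε1 : ε ≤ 1) (hL : 0 ≤ L)
    {C : ℝ} (hC : 0 ≤ C) :
    ∃ K, 0 ≤ K ∧ ∀ (c d c' d' : ℝ) (u v u' v' : ℝ → ℝ), c ∈ Icc 0 C → d ∈ Icc 0 C →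
      IsClampedSol E F ε c d L u v → IsClampedSol E F ε c' d' L u' v' →
      ∀ r ∈ Icc 0 L, |u r - u' r| ≤ K * (|c - c'| + |d - d'|) ∧
        |v r - v' r| ≤ K * (|c - c'| + |d - d'|) := by
  obtain ⟨K₁, hK₁, hLip₁⟩ := E.exists_lipschitz_decay hε
  obtain ⟨K₂, hK₂, hLip₂⟩ := F.exists_lipschitz_decay hε
  set lam : ℝ := 2 * (C * K₁ + C * K₂) + 1 with hlam_def
  have hlam : 0 < lam := by positivity
  set Λ : ℝ → ℝ := growthWeight lam E.α F.α with hΛ_def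
  have hΛpos : ∀ x, 0 < Λ x := growthWeight_pos _ _ _
  have hΛc : Continuous Λ := continuous_growthWeight E.α_gt F.α_gt
  have hΛm : MonotoneOn Λ (Icc 0 L) :=
    (monotoneOn_growthWeight hlam.le E.α_gt F.α_gt).mono Icc_subset_Ici_self
  have hΛ₁ : ∀ r ∈ Icc 0 L, lam * ∫ τ in (0 : ℝ)..r, τ ^ E.α * Λ τ ≤ Λ r := fun r hr =>
    mul_integral_growthWeight_le hlam E.α_gt F.α_gt hr.1
  have hΛ₂ : ∀ r ∈ Icc 0 L, lam * ∫ τ in (0 : ℝ)..r, τ ^ F.α * Λ τ ≤ Λ r := fun r hr => by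
    rw [hΛ_def, growthWeight_comm]
    exact mul_integral_growthWeight_le hlam F.α_gt E.α_gt hr.1
  set D₁ := (1 / E.A) ^ E.κ * (L ^ (E.α + 1) / (E.α + 1)) with hD₁
  set D₂ := (1 / F.A) ^ F.κ * (L ^ (F.α + 1) / (F.α + 1)) with hD₂
  have hD {G : RadialEqn} : 0 ≤ (1 / G.A) ^ G.κ * (L ^ (G.α + 1) / (G.α + 1)) :=
    mul_nonneg (Real.rpow_nonneg (one_div_nonneg.2 G.A_pos.le) _)
      (div_nonneg (Real.rpow_nonneg hL _) (by linarith [G.α_gt]))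
  have hD₁0 : 0 ≤ D₁ := hD
  have hD₂0 : 0 ≤ D₂ := hD
  refine ⟨2 * (D₁ + D₂) * Λ L, by have := (hΛpos L).le; positivity,
    fun c d c' d' u v u' v' hc hd h h' => ?_⟩
  set S := |c - c'| + |d - d'| with hS
  have hS0 : 0 ≤ S := by positivity
  -- `M` is the largest value of the difference of the two solutions, relative to the weight.
  obtain ⟨r₀, hr₀, hmax⟩ := isCompact_Icc.exists_isMaxOn (nonempty_Icc.2 hL)
    (f := fun r => max |u r - u' r| |v r - v' r| / Λ r)
    (((h.cont_u.sub h'.cont_u).abs.sup (h.cont_v.sub h'.cont_v).abs).div hΛc.continuousOn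
      fun x _ => (hΛpos x).ne')
  set M := max |u r₀ - u' r₀| |v r₀ - v' r₀| / Λ r₀ with hM
  have hM0 : 0 ≤ M := div_nonneg (le_max_of_le_left (abs_nonneg _)) (hΛpos _).le
  have hle : ∀ x ∈ Icc 0 L, max |u x - u' x| |v x - v' x| ≤ M * Λ x := fun x hx =>
    (div_le_iff₀ (hΛpos x)).1 (hmax hx)
  have hu : ∀ x ∈ Icc 0 L, |clampUnit ε (u x) - clampUnit ε (u' x)| ≤ M * Λ x := fun x hx =>
    (abs_clampUnit_sub_le _ _ _).trans ((le_max_left _ _).trans (hle x hx))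
  have hv : ∀ x ∈ Icc 0 L, |clampUnit ε (v x) - clampUnit ε (v' x)| ≤ M * Λ x := fun x hx =>
    (abs_clampUnit_sub_le _ _ _).trans ((le_max_right _ _).trans (hle x hx))
  have hb := inBand_clampUnit hε1 h.cont_u h.cont_v
  have hb' := inBand_clampUnit hε1 h'.cont_u h'.cont_v
  have hstep : ∀ {e e' K D X Y x : ℝ}, 0 ≤ e → 0 ≤ D → D ≤ D₁ + D₂ → e * K ≤ lam / 2 →
      |e - e'| ≤ S → x ∈ Icc 0 L →
      |Y| ≤ D → |X - Y| ≤ K * M / lam * Λ x →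
      |(1 - e * X) - (1 - e' * Y)| ≤ ((D₁ + D₂) * S + M / 2) * Λ x := by
    intro e e' K D X Y x he hD0 hDle hK hee hx hY hXY
    have e1 : (1 - e * X) - (1 - e' * Y) = (e' - e) * Y + e * (Y - X) := by ring
    have hΛ1 : 1 ≤ Λ x := one_le_growthWeight hlam.le E.α_gt F.α_gt hx.1
    have t1 : |e - e'| * |Y| ≤ (D₁ + D₂) * S * Λ x := by
      calc |e - e'| * |Y| ≤ S * (D₁ + D₂) :=
            mul_le_mul hee (hY.trans hDle) (abs_nonneg _) hS0
        _ = (D₁ + D₂) * S * 1 := by ring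
        _ ≤ _ := mul_le_mul_of_nonneg_left hΛ1 (by positivity)
    have t2 : e * |X - Y| ≤ M / 2 * Λ x := by
      calc e * |X - Y| ≤ e * (K * M / lam * Λ x) := mul_le_mul_of_nonneg_left hXY he
        _ = e * K / lam * M * Λ x := by ring
        _ ≤ 1 / 2 * M * Λ x := by
          refine mul_le_mul_of_nonneg_right (mul_le_mul_of_nonneg_right ?_ hM0) (hΛpos x).le
          rw [div_le_iff₀ hlam]; linarith
        _ = _ := by ring
    rw [e1]
    refine (abs_add_le _ _).trans ?_
    rw [abs_mul, abs_mul, abs_of_nonneg he, abs_sub_comm e', abs_sub_comm Y]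
    linarith
  have hCK {e : ℝ} (he : e ∈ Icc 0 C) : e * K₁ ≤ lam / 2 ∧ e * K₂ ≤ lam / 2 := by
    have a1 := mul_le_mul_of_nonneg_right he.2 hK₁
    have a2 := mul_le_mul_of_nonneg_right he.2 hK₂
    have a3 := mul_nonneg hC hK₁
    have a4 := mul_nonneg hC hK₂
    rw [hlam_def]
    constructor <;> linarith
  have hM2 : M ≤ (D₁ + D₂) * S + M / 2 := by
    rw [hM, div_le_iff₀ (hΛpos r₀), ← hM]
    refine max_le ?_ ?_
    · rw [h.eq_u r₀ hr₀, h'.eq_u r₀ hr₀]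
      exact hstep hc.1 hD₁0 (by linarith) (hCK hc).1
        (by rw [hS]; linarith [abs_nonneg (d - d')]) hr₀ (E.abs_decay_le hε hb' hr₀)
        (hLip₁ L _ _ _ _ _ lam Λ hM0 hlam hb hb' hΛc.continuousOn hΛm hΛ₁ hu hv r₀ hr₀)
    · rw [h.eq_v r₀ hr₀, h'.eq_v r₀ hr₀]
      exact hstep hd.1 hD₂0 (by linarith) (hCK hd).2
        (by rw [hS]; linarith [abs_nonneg (c - c')]) hr₀ (F.abs_decay_le hε hb'.symm hr₀)
        (hLip₂ L _ _ _ _ _ lam Λ hM0 hlam hb.symm hb'.symm hΛc.continuousOn hΛm hΛ₂ hv hu r₀ hr₀)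
  intro r hr
  have hfin : max |u r - u' r| |v r - v' r| ≤ 2 * (D₁ + D₂) * Λ L * S := by
    calc _ ≤ M * Λ r := hle r hr
      _ ≤ (2 * (D₁ + D₂) * S) * Λ L :=
        mul_le_mul (by linarith) (hΛm hr (right_mem_Icc.2 hL) hr.2) (hΛpos r).le (by positivity)
      _ = _ := by ring
  exact ⟨(le_max_left _ _).trans hfin, (le_max_right _ _).trans hfin⟩

lemma IsClampedSol.eqOn (hε : 0 < ε) (hε1 : ε ≤ 1) (hc : 0 ≤ c) (hd : 0 ≤ d)
    (h : IsClampedSol E F ε c d L u v) (h' : IsClampedSol E F ε c d L u' v') :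
    EqOn u u' (Icc 0 L) ∧ EqOn v v' (Icc 0 L) := by
  rcases lt_or_ge L 0 with hL | hL
  · simp [Icc_eq_empty_of_lt hL]
  obtain ⟨K, -, hK⟩ := exists_isClampedSol_lipschitz E F hε hε1 hL (le_max_of_le_left hc :
    0 ≤ max c d)
  have := hK c d c d u v u' v' ⟨hc, le_max_left _ _⟩ ⟨hd, le_max_right _ _⟩ h h'
  simp only [sub_self, abs_zero, add_zero, mul_zero, abs_nonpos_iff, sub_eq_zero] at this
  exact ⟨fun r hr => (this r hr).1, fun r hr => (this r hr).2⟩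

end Clamped

/-! ### Positive solutions: uniqueness, continuation, dependence on the strengths -/

/-- A positive solution on `[0, L]` of the normalized integral system with strengths `c` and `d`; both
unknowns equal `1` at the origin. -/
structure IsSol (E F : RadialEqn) (c d L : ℝ) (u v : ℝ → ℝ) : Prop where
  L_nonneg : 0 ≤ L
  cont_u : ContinuousOn u (Icc 0 L)
  cont_v : ContinuousOn v (Icc 0 L)
  pos_u : ∀ r ∈ Icc 0 L, 0 < u r
  pos_v : ∀ r ∈ Icc 0 L, 0 < v r
  eq_u : ∀ r ∈ Icc 0 L, u r = 1 - c * E.decay u v r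
  eq_v : ∀ r ∈ Icc 0 L, v r = 1 - d * F.decay v u r

namespace IsSol

variable {E F : RadialEqn} {ε c d L L' r : ℝ} {u v u' v' : ℝ → ℝ}

lemma symm (h : IsSol E F c d L u v) : IsSol F E d c L v u :=
  ⟨h.L_nonneg, h.cont_v, h.cont_u, h.pos_v, h.pos_u, h.eq_v, h.eq_u⟩

lemma mono (h : IsSol E F c d L u v) (hr0 : 0 ≤ r) (hr : r ≤ L) : IsSol E F c d r u v where
  L_nonneg := hr0
  cont_u := h.cont_u.mono (Icc_subset_Icc_right hr)
  cont_v := h.cont_v.mono (Icc_subset_Icc_right hr)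
  pos_u := fun x hx => h.pos_u x (Icc_subset_Icc_right hr hx)
  pos_v := fun x hx => h.pos_v x (Icc_subset_Icc_right hr hx)
  eq_u := fun x hx => h.eq_u x (Icc_subset_Icc_right hr hx)
  eq_v := fun x hx => h.eq_v x (Icc_subset_Icc_right hr hx)

lemma congr (h : IsSol E F c d L u v) (hu : EqOn u' u (Icc 0 L)) (hv : EqOn v' v (Icc 0 L)) :
    IsSol E F c d L u' v' where
  L_nonneg := h.L_nonneg
  cont_u := h.cont_u.congr hu
  cont_v := h.cont_v.congr hv
  pos_u := fun x hx => hu hx ▸ h.pos_u x hx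
  pos_v := fun x hx => hv hx ▸ h.pos_v x hx
  eq_u := fun x hx => by
    rw [hu hx, h.eq_u x hx, E.decay_congr hx.1 (hu.mono (Icc_subset_Icc_right hx.2))
      (hv.mono (Icc_subset_Icc_right hx.2))]
  eq_v := fun x hx => by
    rw [hv hx, h.eq_v x hx, F.decay_congr hx.1 (hv.mono (Icc_subset_Icc_right hx.2))
      (hu.mono (Icc_subset_Icc_right hx.2))]

lemma apply_zero (h : IsSol E F c d L u v) : u 0 = 1 := by
  rw [h.eq_u 0 ⟨le_rfl, h.L_nonneg⟩, E.decay_zero, mul_zero, sub_zero]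

lemma mean_pos (h : IsSol E F c d L u v) (hr : r ∈ Icc 0 L) : 0 < E.mean u v r := by
  have hc := E.continuousOn_force (h.mono hr.1 hr.2).cont_u (h.mono hr.1 hr.2).cont_v
  obtain ⟨x, hx, hmin⟩ := isCompact_Icc.exists_isMinOn (nonempty_Icc.2 hr.1) hc
  have hxL : x ∈ Icc 0 L := ⟨hx.1, hx.2.trans hr.2⟩
  exact (div_pos (E.force_pos (h.pos_u x hxL) (h.pos_v x hxL)) E.A_pos).trans_le
    (le_radialMean E.A_pos hr.1 hc hmin)

lemma hasDerivAt (h : IsSol E F c d L u v) (hr : r ∈ Ioo 0 L) :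
    HasDerivAt u (-(c * (r ^ E.α * E.mean u v r ^ E.κ))) r := by
  have h1 := ((E.hasDerivAt_decay h.cont_u h.cont_v hr).const_mul c).const_sub 1
  refine h1.congr_of_eventuallyEq ?_
  filter_upwards [Ioo_mem_nhds hr.1 hr.2] with x hx
  exact h.eq_u x (Ioo_subset_Icc_self hx)

lemma antitoneOn (h : IsSol E F c d L u v) (hc : 0 ≤ c) : AntitoneOn u (Icc 0 L) := by
  refine antitoneOn_of_hasDerivWithinAt_nonpos (convex_Icc 0 L) h.cont_u
    (f' := fun r => -(c * (r ^ E.α * E.mean u v r ^ E.κ))) (fun r hr => ?_) fun r hr => ?_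
  · rw [interior_Icc] at hr ⊢
    exact (h.hasDerivAt hr).hasDerivWithinAt
  · rw [interior_Icc] at hr
    have := (h.mean_pos (Ioo_subset_Icc_self hr)).le
    have := Real.rpow_nonneg hr.1.le E.α
    rw [neg_nonpos]
    positivity

lemma le_one (h : IsSol E F c d L u v) (hc : 0 ≤ c) (hr : r ∈ Icc 0 L) : u r ≤ 1 :=
  h.apply_zero ▸ h.antitoneOn hc ⟨le_rfl, h.L_nonneg⟩ hr hr.1

lemma exists_lower_bound (h : IsSol E F c d L u v) (hc : 0 ≤ c) (hd : 0 ≤ d) :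
    ∃ ε, 0 < ε ∧ ε ≤ 1 ∧ ∀ r ∈ Icc 0 L, ε ≤ u r ∧ ε ≤ v r := by
  have hL : L ∈ Icc 0 L := ⟨h.L_nonneg, le_rfl⟩
  exact ⟨min (u L) (v L), lt_min (h.pos_u L hL) (h.pos_v L hL),
    (min_le_left _ _).trans (h.le_one hc hL), fun r hr =>
    ⟨(min_le_left _ _).trans (h.antitoneOn hc hr hL hr.2),
      (min_le_right _ _).trans (h.symm.antitoneOn hd hr hL hr.2)⟩⟩

lemma isClampedSol (h : IsSol E F c d L u v) (hc : 0 ≤ c) (hd : 0 ≤ d)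
    (hε : ∀ r ∈ Icc 0 L, ε ≤ u r ∧ ε ≤ v r) : IsClampedSol E F ε c d L u v where
  cont_u := h.cont_u
  cont_v := h.cont_v
  eq_u := fun r hr => by
    rw [h.eq_u r hr]
    congr 2
    exact E.decay_congr hr.1
      (fun x hx => (clampUnit_of_mem ⟨(hε x ⟨hx.1, hx.2.trans hr.2⟩).1,
        h.le_one hc ⟨hx.1, hx.2.trans hr.2⟩⟩).symm)
      (fun x hx => (clampUnit_of_mem ⟨(hε x ⟨hx.1, hx.2.trans hr.2⟩).2,
        h.symm.le_one hd ⟨hx.1, hx.2.trans hr.2⟩⟩).symm)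
  eq_v := fun r hr => by
    rw [h.eq_v r hr]
    congr 2
    exact F.decay_congr hr.1
      (fun x hx => (clampUnit_of_mem ⟨(hε x ⟨hx.1, hx.2.trans hr.2⟩).2,
        h.symm.le_one hd ⟨hx.1, hx.2.trans hr.2⟩⟩).symm)
      (fun x hx => (clampUnit_of_mem ⟨(hε x ⟨hx.1, hx.2.trans hr.2⟩).1,
        h.le_one hc ⟨hx.1, hx.2.trans hr.2⟩⟩).symm)

/-- A positive solution is determined by the strengths. -/
lemma eqOn (h : IsSol E F c d L u v) (h' : IsSol E F c d L u' v') (hc : 0 ≤ c) (hd : 0 ≤ d) :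
    EqOn u u' (Icc 0 L) ∧ EqOn v v' (Icc 0 L) := by
  obtain ⟨ε, hε, hε1, hb⟩ := h.exists_lower_bound hc hd
  obtain ⟨ε', hε', hε1', hb'⟩ := h'.exists_lower_bound hc hd
  have hm : 0 < min ε ε' := lt_min hε hε'
  exact (h.isClampedSol hc hd (ε := min ε ε') fun r hr => ⟨(min_le_left _ _).trans (hb r hr).1,
      (min_le_left _ _).trans (hb r hr).2⟩).eqOn hm ((min_le_left _ _).trans hε1) hc hd
    (h'.isClampedSol hc hd fun r hr => ⟨(min_le_right _ _).trans (hb' r hr).1,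
      (min_le_right _ _).trans (hb' r hr).2⟩)

end IsSol

section Continuation

variable {E F : RadialEqn} {ε c d L L' r : ℝ} {u v u' v' : ℝ → ℝ}

lemma IsClampedSol.le_one (h : IsClampedSol E F ε c d L u v) (hε : 0 < ε) (hε1 : ε ≤ 1)
    (hc : 0 ≤ c) (hr : r ∈ Icc 0 L) : u r ≤ 1 := by
  have hb := inBand_clampUnit hε1 h.cont_u h.cont_v
  have : 0 ≤ E.decay (fun x => clampUnit ε (u x)) (fun x => clampUnit ε (v x)) r := by
    refine intervalIntegral.integral_nonneg hr.1 fun τ hτ => ?_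
    have hbτ := hb.mono (hτ.2.trans hr.2)
    exact mul_nonneg (Real.rpow_nonneg hτ.1 _) (Real.rpow_nonneg (E.mean_nonneg hτ.1 hbτ.cont_u
      hbτ.cont_v (fun x hx => hε.le.trans (hbτ.mem_u x hx).1)
      fun x hx => hε.le.trans (hbτ.mem_v x hx).1) _)
  rw [h.eq_u r hr]
  have := mul_nonneg hc this
  linarith

lemma IsClampedSol.symm (h : IsClampedSol E F ε c d L u v) : IsClampedSol F E ε d c L v u :=
  ⟨h.cont_v, h.cont_u, h.eq_v, h.eq_u⟩

lemma IsClampedSol.isSol (h : IsClampedSol E F ε c d L u v) (hε : 0 < ε) (hε1 : ε ≤ 1)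
    (hc : 0 ≤ c) (hd : 0 ≤ d) (hL : 0 ≤ L) (hb : ∀ r ∈ Icc 0 L, ε ≤ u r ∧ ε ≤ v r) :
    IsSol E F c d L u v where
  L_nonneg := hL
  cont_u := h.cont_u
  cont_v := h.cont_v
  pos_u := fun r hr => hε.trans_le (hb r hr).1
  pos_v := fun r hr => hε.trans_le (hb r hr).2
  eq_u := fun r hr => by
    rw [h.eq_u r hr]
    congr 2
    exact E.decay_congr hr.1
      (fun x hx => clampUnit_of_mem ⟨(hb x ⟨hx.1, hx.2.trans hr.2⟩).1,
        h.le_one hε hε1 hc ⟨hx.1, hx.2.trans hr.2⟩⟩)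
      (fun x hx => clampUnit_of_mem ⟨(hb x ⟨hx.1, hx.2.trans hr.2⟩).2,
        h.symm.le_one hε hε1 hd ⟨hx.1, hx.2.trans hr.2⟩⟩)
  eq_v := fun r hr => by
    rw [h.eq_v r hr]
    congr 2
    exact F.decay_congr hr.1
      (fun x hx => clampUnit_of_mem ⟨(hb x ⟨hx.1, hx.2.trans hr.2⟩).2,
        h.symm.le_one hε hε1 hd ⟨hx.1, hx.2.trans hr.2⟩⟩)
      (fun x hx => clampUnit_of_mem ⟨(hb x ⟨hx.1, hx.2.trans hr.2⟩).1,
        h.le_one hε hε1 hc ⟨hx.1, hx.2.trans hr.2⟩⟩)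

lemma isSol_zero (E F : RadialEqn) (c d : ℝ) : IsSol E F c d 0 (fun _ => 1) (fun _ => 1) where
  L_nonneg := le_rfl
  cont_u := continuousOn_const
  cont_v := continuousOn_const
  pos_u := fun _ _ => one_pos
  pos_v := fun _ _ => one_pos
  eq_u := fun r hr => by
    obtain rfl : r = 0 := le_antisymm hr.2 hr.1
    rw [E.decay_zero, mul_zero, sub_zero]
  eq_v := fun r hr => by
    obtain rfl : r = 0 := le_antisymm hr.2 hr.1
    rw [F.decay_zero, mul_zero, sub_zero]

/-- A positive solution on a closed interval continues to a larger one. -/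
lemma IsSol.exists_extension (h : IsSol E F c d L u v) (hc : 0 ≤ c) (hd : 0 ≤ d) :
    ∃ L' u' v', L < L' ∧ IsSol E F c d L' u' v' := by
  obtain ⟨ε, hε, hε1, hb⟩ := h.exists_lower_bound hc hd
  have hL := h.L_nonneg
  have hε2 : ε / 2 ≤ 1 := by linarith
  obtain ⟨U, V, hUV⟩ := exists_isClampedSol (L := L + 1) E F (half_pos hε) hε2 hc hd (by linarith)
  have heq := (h.isClampedSol hc hd (ε := ε / 2) fun r hr =>
    ⟨by linarith [(hb r hr).1], by linarith [(hb r hr).2]⟩).eqOn (half_pos hε) hε2 hc hd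
    (hUV.mono (by linarith))
  have hmem : L ∈ Icc 0 (L + 1) := ⟨hL, by linarith⟩
  have hLL : L ∈ Icc 0 L := ⟨hL, le_rfl⟩
  -- The clamped solution stays above the clamping level slightly beyond `L`.
  have hlim {W : ℝ → ℝ} (hW : ContinuousOn W (Icc 0 (L + 1))) (hWL : ε ≤ W L) :
      ∀ᶠ x in 𝓝[>] L, ε / 2 < W x := by
    have h1 : Tendsto W (𝓝[>] L) (𝓝 (W L)) :=
      (hW L hmem).mono_left (nhdsWithin_le_of_mem (mem_of_superset
        (Ioo_mem_nhdsGT (show L < L + 1 by linarith)) fun x hx => ⟨hL.trans hx.1.le, hx.2.le⟩))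
    exact h1.eventually (lt_mem_nhds (by linarith))
  have hev := (hlim hUV.cont_u (by rw [← heq.1 hLL]; exact (hb L hLL).1)).and
    (hlim hUV.cont_v (by rw [← heq.2 hLL]; exact (hb L hLL).2))
  obtain ⟨b, hbL, hsub⟩ := (mem_nhdsGT_iff_exists_Ioo_subset' (show L < L + 1 by linarith)).1 hev
  have hbL' : L < b := hbL
  set L' := min (L + 1) ((L + b) / 2) with hL'
  have h1 : L < L' := lt_min (by linarith) (by linarith)
  have h2 : L' ≤ L + 1 := min_le_left _ _
  have h3 : L' < b := (min_le_right _ _).trans_lt (by linarith)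
  refine ⟨L', U, V, h1, (hUV.mono h2).isSol (half_pos hε) hε2 hc hd (hL.trans h1.le)
    fun r hr => ?_⟩
  rcases le_or_gt r L with hrL | hrL
  · rw [← heq.1 ⟨hr.1, hrL⟩, ← heq.2 ⟨hr.1, hrL⟩]
    have := hb r ⟨hr.1, hrL⟩
    constructor <;> linarith [this.1, this.2]
  · have := hsub ⟨hrL, hr.2.trans_lt h3⟩
    exact ⟨this.1.le, this.2.le⟩

/-- Solutions on all shorter intervals that stay above a common level give a solution on the closed
interval. -/
lemma exists_isSol_of_lower_bound (hc : 0 ≤ c) (hd : 0 ≤ d) (hL : 0 < L) (hε : 0 < ε)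
    (h : ∀ r ∈ Ico 0 L, ∃ u v, IsSol E F c d r u v ∧ ε ≤ u r ∧ ε ≤ v r) :
    ∃ u v, IsSol E F c d L u v := by
  have hε1 : ε ≤ 1 := by
    obtain ⟨u, v, hs, hu, -⟩ := h 0 ⟨le_rfl, hL⟩
    exact hu.trans (hs.le_one hc ⟨le_rfl, le_rfl⟩)
  obtain ⟨U, V, hUV⟩ := exists_isClampedSol (L := L) E F hε hε1 hc hd hL.le
  have hIco : ∀ r ∈ Ico 0 L, ε ≤ U r ∧ ε ≤ V r := by
    intro r hr
    obtain ⟨u, v, hs, hu, hv⟩ := h r hr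
    have hrr : r ∈ Icc 0 r := ⟨hr.1, le_rfl⟩
    have heq := (hs.isClampedSol hc hd (ε := ε) fun x hx =>
      ⟨hu.trans (hs.antitoneOn hc hx hrr hx.2), hv.trans (hs.symm.antitoneOn hd hx hrr hx.2)⟩).eqOn
      hε hε1 hc hd (hUV.mono hr.2.le)
    rw [← heq.1 hrr, ← heq.2 hrr]
    exact ⟨hu, hv⟩
  have hcl : closure (Ico 0 L) = Icc 0 L := closure_Ico hL.ne
  refine ⟨U, V, hUV.isSol hε hε1 hc hd hL.le fun r hr => ?_⟩
  rw [← hcl] at hr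
  exact ⟨continuousWithinAt_const.closure_le hr
      ((hUV.cont_u r (hcl ▸ hr)).mono Ico_subset_Icc_self) fun x hx => (hIco x hx).1,
    continuousWithinAt_const.closure_le hr
      ((hUV.cont_v r (hcl ▸ hr)).mono Ico_subset_Icc_self) fun x hx => (hIco x hx).2⟩

/-- Continuous dependence: when the strengths vary continuously, a positive solution on `[0, L]`
persists, and the values of the unknowns and the means at `L` vary continuously. -/
lemma IsSol.exists_perturbation {c d : ℝ → ℝ} (hc : Continuous c) (hd : Continuous d)
    (hc0 : ∀ θ, 0 ≤ c θ) (hd0 : ∀ θ, 0 ≤ d θ) {θ₀ : ℝ} (h : IsSol E F (c θ₀) (d θ₀) L u v) :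
    ∃ us vs : ℝ → ℝ → ℝ, (∀ᶠ θ in 𝓝 θ₀, IsSol E F (c θ) (d θ) L (us θ) (vs θ)) ∧
      Tendsto (fun θ => us θ L) (𝓝 θ₀) (𝓝 (u L)) ∧
      Tendsto (fun θ => vs θ L) (𝓝 θ₀) (𝓝 (v L)) ∧
      Tendsto (fun θ => E.mean (us θ) (vs θ) L ^ E.κ) (𝓝 θ₀) (𝓝 (E.mean u v L ^ E.κ)) ∧
      Tendsto (fun θ => F.mean (vs θ) (us θ) L ^ F.κ) (𝓝 θ₀) (𝓝 (F.mean v u L ^ F.κ)) := by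
  obtain ⟨ε, hε, hε1, hb⟩ := h.exists_lower_bound (hc0 θ₀) (hd0 θ₀)
  have hL := h.L_nonneg
  have hLL : L ∈ Icc 0 L := ⟨hL, le_rfl⟩
  have hε2 : ε / 2 ≤ 1 := by linarith
  have hex : ∀ θ, ∃ U V, IsClampedSol E F (ε / 2) (c θ) (d θ) L U V := fun θ =>
    exists_isClampedSol E F (half_pos hε) hε2 (hc0 θ) (hd0 θ) hL
  choose us vs hs using hex
  have hcl := h.isClampedSol (hc0 θ₀) (hd0 θ₀) (ε := ε / 2) fun r hr =>
    ⟨by linarith [(hb r hr).1], by linarith [(hb r hr).2]⟩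
  obtain ⟨K, hK, hLip⟩ := exists_isClampedSol_lipschitz E F (half_pos hε) hε2 hL
    (le_max_of_le_left (hc0 θ₀) : 0 ≤ max (c θ₀) (d θ₀))
  set B : ℝ → ℝ := fun θ => K * (|c θ₀ - c θ| + |d θ₀ - d θ|) with hB
  have hclose : ∀ θ, ∀ r ∈ Icc 0 L, |u r - us θ r| ≤ B θ ∧ |v r - vs θ r| ≤ B θ := fun θ =>
    hLip _ _ _ _ _ _ _ _ ⟨hc0 θ₀, le_max_left _ _⟩ ⟨hd0 θ₀, le_max_right _ _⟩ hcl (hs θ)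
  have hBlim : Tendsto B (𝓝 θ₀) (𝓝 0) := by
    have : Continuous B := by fun_prop
    simpa [hB] using this.tendsto θ₀
  have hBε : ∀ᶠ θ in 𝓝 θ₀, B θ < ε / 2 := hBlim.eventually (gt_mem_nhds (half_pos hε))
  have hge : ∀ᶠ θ in 𝓝 θ₀, ∀ r ∈ Icc 0 L, ε / 2 ≤ us θ r ∧ ε / 2 ≤ vs θ r := by
    filter_upwards [hBε] with θ hθ r hr
    have h1 := hclose θ r hr
    have h2 := hb r hr
    constructor
    · linarith [(abs_le.1 h1.1).2, h2.1]
    · linarith [(abs_le.1 h1.2).2, h2.2]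
  have hsol : ∀ᶠ θ in 𝓝 θ₀, IsSol E F (c θ) (d θ) L (us θ) (vs θ) := by
    filter_upwards [hge] with θ hθ
    exact (hs θ).isSol (half_pos hε) hε2 (hc0 θ) (hd0 θ) hL hθ
  have hlim : ∀ {X : ℝ → ℝ} {x K' : ℝ}, (∀ᶠ θ in 𝓝 θ₀, |x - X θ| ≤ K' * B θ) →
      Tendsto X (𝓝 θ₀) (𝓝 x) := by
    intro X x K' hX
    rw [tendsto_iff_norm_sub_tendsto_zero]
    refine squeeze_zero' (Eventually.of_forall fun _ => norm_nonneg _)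
      (hX.mono fun θ hθ => ?_) (by simpa using hBlim.const_mul K')
    rwa [Real.norm_eq_abs, abs_sub_comm]
  have hband : InBand (ε / 2) L u v := ⟨h.cont_u, h.cont_v,
    fun r hr => ⟨by linarith [(hb r hr).1], h.le_one (hc0 θ₀) hr⟩,
    fun r hr => ⟨by linarith [(hb r hr).2], h.symm.le_one (hd0 θ₀) hr⟩⟩
  have hbands : ∀ᶠ θ in 𝓝 θ₀, InBand (ε / 2) L (us θ) (vs θ) := by
    filter_upwards [hge, hsol] with θ hθ h'
    exact ⟨h'.cont_u, h'.cont_v, fun r hr => ⟨(hθ r hr).1, h'.le_one (hc0 θ) hr⟩,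
      fun r hr => ⟨(hθ r hr).2, h'.symm.le_one (hd0 θ) hr⟩⟩
  obtain ⟨K₁, -, hK₁⟩ := E.exists_lipschitz_mean_rpow (half_pos hε)
  obtain ⟨K₂, -, hK₂⟩ := F.exists_lipschitz_mean_rpow (half_pos hε)
  refine ⟨us, vs, hsol, hlim (K' := 1) ?_, hlim (K' := 1) ?_, hlim (K' := K₁) ?_,
    hlim (K' := K₂) ?_⟩
  · exact Eventually.of_forall fun θ => by rw [one_mul]; exact (hclose θ L hLL).1
  · exact Eventually.of_forall fun θ => by rw [one_mul]; exact (hclose θ L hLL).2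
  · filter_upwards [hbands] with θ hθ
    exact hK₁ L _ _ _ _ _ hL hband hθ (fun r hr => (hclose θ r hr).1)
      fun r hr => (hclose θ r hr).2
  · filter_upwards [hbands] with θ hθ
    exact hK₂ L _ _ _ _ _ hL hband.symm hθ.symm (fun r hr => (hclose θ r hr).2)
      fun r hr => (hclose θ r hr).1

end Continuation

/-! ### Logarithmic slopes and their monotonicity -/

namespace RadialEqn

variable (E : RadialEqn)

/-- The exponent `κ A - α - 1` of the fundamental solution `r ^ (-crit)`; it is
`(N - p) / (p - 1)` for the `p`-Laplacian in `ℝ ^ N`. -/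
def crit : ℝ := E.κ * E.A - E.α - 1

lemma crit_pos : 0 < E.crit := by have := E.lt_mul; unfold crit; linarith

lemma α_add_one_pos : 0 < E.α + 1 := by linarith [E.α_gt]

/-- The quantity `-r u' r` for a solution of strength `c`, in integral form. -/
noncomputable def slope (c : ℝ) (u v : ℝ → ℝ) (r : ℝ) : ℝ :=
  c * (r ^ (E.α + 1) * E.mean u v r ^ E.κ)

/-- The quantity `crit * u r + r u' r`: it is positive as long as the phase variable `-r u' / u` stays
below `crit`. -/
noncomputable def gap (c : ℝ) (u v : ℝ → ℝ) (r : ℝ) : ℝ := E.crit * u r - E.slope c u v r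

end RadialEqn

namespace IsSol

variable {E F : RadialEqn} {c d L r r' : ℝ} {u v : ℝ → ℝ}

lemma hasDerivAt_slope_div (h : IsSol E F c d L u v) (hr : r ∈ Ioo 0 L) :
    HasDerivAt u (-(E.slope c u v r / r)) r := by
  convert h.hasDerivAt hr using 2
  rw [RadialEqn.slope, Real.rpow_add_one hr.1.ne']
  have := hr.1.ne'
  field_simp

lemma continuousOn_slope (h : IsSol E F c d L u v) :
    ContinuousOn (E.slope c u v) (Icc 0 L) :=
  continuousOn_const.mul ((continuousOn_id.rpow_const fun _ _ => Or.inr E.α_add_one_pos.le).mul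
    (E.continuousOn_mean_rpow h.cont_u h.cont_v))

lemma continuousOn_gap (h : IsSol E F c d L u v) : ContinuousOn (E.gap c u v) (Icc 0 L) :=
  (continuousOn_const.mul h.cont_u).sub h.continuousOn_slope

lemma slope_nonneg (h : IsSol E F c d L u v) (hc : 0 ≤ c) (hr : r ∈ Icc 0 L) :
    0 ≤ E.slope c u v r :=
  mul_nonneg hc (mul_nonneg (Real.rpow_nonneg hr.1 _) (Real.rpow_nonneg (h.mean_pos hr).le _))

lemma slope_pos (h : IsSol E F c d L u v) (hc : 0 < c) (hr : r ∈ Ioc 0 L) :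
    0 < E.slope c u v r :=
  mul_pos hc (mul_pos (Real.rpow_pos_of_pos hr.1 _)
    (Real.rpow_pos_of_pos (h.mean_pos (Ioc_subset_Icc_self hr)) _))

lemma slope_zero : E.slope c u v 0 = 0 := by
  rw [RadialEqn.slope, Real.zero_rpow E.α_add_one_pos.ne', zero_mul, mul_zero]

lemma gap_zero (h : IsSol E F c d L u v) : E.gap c u v 0 = E.crit := by
  rw [RadialEqn.gap, slope_zero, h.apply_zero, mul_one, sub_zero]

lemma slope_eq (h : IsSol E F c d L u v) (hr : r ∈ Ioc 0 L) :
    E.slope c u v r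
      = c * (r ^ (-E.crit) * (∫ σ in (0 : ℝ)..r, σ ^ (E.A - 1) * E.force u v σ) ^ E.κ) := by
  rw [← rpow_mul_radialMean hr.1]
  change _ = c * (r ^ (-E.crit) * (r ^ E.A * E.mean u v r) ^ E.κ)
  rw [Real.mul_rpow (Real.rpow_nonneg hr.1.le _)
    (h.mean_pos (Ioc_subset_Icc_self hr)).le, ← Real.rpow_mul hr.1.le, ← mul_assoc (r ^ (-E.crit)),
    ← Real.rpow_add hr.1]
  have : -E.crit + E.A * E.κ = E.α + 1 := by unfold RadialEqn.crit; ring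
  rw [this]
  rfl

lemma mass_pos (h : IsSol E F c d L u v) (hr : r ∈ Ioc 0 L) :
    0 < ∫ σ in (0 : ℝ)..r, σ ^ (E.A - 1) * E.force u v σ := by
  rw [← rpow_mul_radialMean hr.1]
  exact mul_pos (Real.rpow_pos_of_pos hr.1 _) (h.mean_pos (Ioc_subset_Icc_self hr))

lemma hasDerivAt_mass (h : IsSol E F c d L u v) (hr : r ∈ Ioo 0 L) :
    HasDerivAt (fun x => ∫ σ in (0 : ℝ)..x, σ ^ (E.A - 1) * E.force u v σ)
      (r ^ (E.A - 1) * E.force u v r) r :=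
  hasDerivAt_integral_rpow_mul E.A_pos (E.continuousOn_force h.cont_u h.cont_v) hr

lemma monotoneOn_mass (h : IsSol E F c d L u v) :
    MonotoneOn (fun x => ∫ σ in (0 : ℝ)..x, σ ^ (E.A - 1) * E.force u v σ) (Ioc 0 L) := by
  have hI : IntervalIntegrable (fun σ => σ ^ (E.A - 1) * E.force u v σ) volume 0 L :=
    (intervalIntegral.intervalIntegrable_rpow' (by linarith [E.A_pos])).mul_continuousOn
      (by rw [uIcc_of_le h.L_nonneg]; exact E.continuousOn_force h.cont_u h.cont_v)
  intro x hx y hy hxy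
  refine intervalIntegral.integral_mono_interval le_rfl hx.1.le hxy ?_
    (hI.mono_set (by
      rw [uIcc_of_le hy.1.le, uIcc_of_le h.L_nonneg]; exact Icc_subset_Icc_right hy.2))
  refine (ae_restrict_mem measurableSet_Ioc).mono fun σ hσ => ?_
  have hσL : σ ∈ Icc 0 L := ⟨hσ.1.le, hσ.2.trans hy.2⟩
  exact mul_nonneg (Real.rpow_nonneg hσ.1.le _)
    (E.force_pos (h.pos_u σ hσL) (h.pos_v σ hσL)).le

/-- The gap decreases: the term `crit * u'` cancels, and what remains is the rate at which the mass of
the reaction term grows. -/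
lemma hasDerivAt_gap (h : IsSol E F c d L u v) (hr : r ∈ Ioo 0 L) :
    HasDerivAt (E.gap c u v) (-(c * (r ^ (-E.crit) * (E.κ *
      (∫ σ in (0 : ℝ)..r, σ ^ (E.A - 1) * E.force u v σ) ^ (E.κ - 1) *
        (r ^ (E.A - 1) * E.force u v r))))) r := by
  have hrL : r ∈ Ioc 0 L := Ioo_subset_Ioc_self hr
  have hr0 := hr.1.ne'
  have hM := (h.hasDerivAt_mass hr).rpow_const (p := E.κ) (Or.inl (h.mass_pos hrL).ne')
  have hp := Real.hasDerivAt_rpow_const (p := -E.crit) (Or.inl hr0)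
  have hs : HasDerivAt (E.slope c u v) _ r :=
    ((hp.mul hM).const_mul c).congr_of_eventuallyEq (by
      filter_upwards [Ioo_mem_nhds hr.1 hr.2] with x hx
      exact h.slope_eq (Ioo_subset_Ioc_self hx))
  refine (((h.hasDerivAt_slope_div hr).const_mul E.crit).sub hs).congr_deriv ?_
  rw [h.slope_eq hrL, Real.rpow_sub_one hr0 (-E.crit)]
  field_simp
  ring

lemma antitoneOn_gap (h : IsSol E F c d L u v) (hc : 0 ≤ c) :
    AntitoneOn (E.gap c u v) (Icc 0 L) := by
  refine antitoneOn_of_hasDerivWithinAt_nonpos (convex_Icc 0 L) h.continuousOn_gap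
    (fun r hr => (h.hasDerivAt_gap (by rwa [interior_Icc] at hr)).hasDerivWithinAt) fun r hr => ?_
  rw [interior_Icc] at hr
  have h1 := (h.mass_pos (Ioo_subset_Ioc_self hr)).le
  have h2 := (E.force_pos (h.pos_u r (Ioo_subset_Icc_self hr))
    (h.pos_v r (Ioo_subset_Icc_self hr))).le
  rw [neg_nonpos]
  exact mul_nonneg hc (mul_nonneg (Real.rpow_nonneg hr.1.le _) (mul_nonneg (mul_nonneg E.κ_pos.le
    (Real.rpow_nonneg h1 _)) (mul_nonneg (Real.rpow_nonneg hr.1.le _) h2)))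

lemma strictAntiOn_gap (h : IsSol E F c d L u v) (hc : 0 < c) :
    StrictAntiOn (E.gap c u v) (Icc 0 L) := by
  refine strictAntiOn_of_hasDerivWithinAt_neg (convex_Icc 0 L) h.continuousOn_gap
    (fun r hr => (h.hasDerivAt_gap (by rwa [interior_Icc] at hr)).hasDerivWithinAt) fun r hr => ?_
  rw [interior_Icc] at hr
  have h1 := h.mass_pos (Ioo_subset_Ioc_self hr)
  have h2 := E.force_pos (h.pos_u r (Ioo_subset_Icc_self hr))
    (h.pos_v r (Ioo_subset_Icc_self hr))
  rw [neg_lt_zero]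
  exact mul_pos hc (mul_pos (Real.rpow_pos_of_pos hr.1 _) (mul_pos (mul_pos E.κ_pos
    (Real.rpow_pos_of_pos h1 _)) (mul_pos (Real.rpow_pos_of_pos hr.1 _) h2)))

lemma slope_mul_rpow_le (h : IsSol E F c d L u v) (hc : 0 ≤ c) (hr : 0 < r) (hrr : r ≤ r')
    (hr' : r' ≤ L) : r ^ E.crit * E.slope c u v r ≤ r' ^ E.crit * E.slope c u v r' := by
  have hr0 : 0 < r' := hr.trans_le hrr
  have hm : r ∈ Ioc 0 L := ⟨hr, hrr.trans hr'⟩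
  have hm' : r' ∈ Ioc 0 L := ⟨hr0, hr'⟩
  have e : ∀ x ∈ Ioc 0 L, x ^ E.crit * E.slope c u v x
      = c * (∫ σ in (0 : ℝ)..x, σ ^ (E.A - 1) * E.force u v σ) ^ E.κ := fun x hx => by
    rw [h.slope_eq hx, Real.rpow_neg hx.1.le]
    have := (Real.rpow_pos_of_pos hx.1 E.crit).ne'
    field_simp
  rw [e r hm, e r' hm']
  exact mul_le_mul_of_nonneg_left (Real.rpow_le_rpow (h.mass_pos hm).le
    (h.monotoneOn_mass hm hm' hrr) E.κ_pos.le) hc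

/-- Once the gap is negative, `u` falls at least logarithmically. -/
lemma le_add_gap_mul_log (h : IsSol E F c d L u v) (hc : 0 ≤ c) (hr : 0 < r) (hrr : r ≤ r')
    (hr' : r' ≤ L) : u r' ≤ u r + E.gap c u v r * Real.log (r' / r) := by
  have hsub : Icc r r' ⊆ Icc 0 L := Icc_subset_Icc hr.le hr'
  have hanti : AntitoneOn (fun x => u x - E.gap c u v r * Real.log x) (Icc r r') := by
    refine antitoneOn_of_hasDerivWithinAt_nonpos (convex_Icc r r') ?_
      (f' := fun x => -(E.slope c u v x / x) - E.gap c u v r * x⁻¹) (fun x hx => ?_) fun x hx => ?_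
    · exact (h.cont_u.mono hsub).sub (continuousOn_const.mul (Real.continuousOn_log.mono
        fun x hx => (hr.trans_le hx.1).ne'))
    · rw [interior_Icc] at hx
      have hx0 : x ∈ Ioo 0 L := ⟨hr.trans hx.1, hx.2.trans_le hr'⟩
      exact ((h.hasDerivAt_slope_div hx0).sub
        ((Real.hasDerivAt_log hx0.1.ne').const_mul _)).hasDerivWithinAt
    · rw [interior_Icc] at hx
      have hxL : x ∈ Icc 0 L := hsub (Ioo_subset_Icc_self hx)
      have hx0 : 0 < x := hr.trans hx.1
      have h1 := h.antitoneOn_gap hc ⟨hr.le, hrr.trans hr'⟩ hxL hx.1.le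
      have h2 := mul_pos E.crit_pos (h.pos_u x hxL)
      have h3 : E.gap c u v x = E.crit * u x - E.slope c u v x := rfl
      have e : -(E.slope c u v x / x) - E.gap c u v r * x⁻¹
          = -((E.slope c u v x + E.gap c u v r) / x) := by field_simp; ring
      rw [e, neg_nonpos]
      exact div_nonneg (by linarith) hx0.le
  have := hanti ⟨le_rfl, hrr⟩ ⟨hrr, le_rfl⟩ hrr
  simp only at this
  rw [Real.log_div (hr.trans_le hrr).ne' hr.ne']
  linarith

/-- As long as the gap is nonnegative, `u` decays no faster than the fundamental solution. -/
lemma mul_rpow_le_of_gap_nonneg (h : IsSol E F c d L u v) (hc : 0 ≤ c) (hr : 0 < r)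
    (hrL : r ≤ L) (hg : 0 ≤ E.gap c u v L) : r ^ E.crit * u r ≤ L ^ E.crit * u L := by
  have hsub : Icc r L ⊆ Icc 0 L := Icc_subset_Icc_left hr.le
  have hmono : MonotoneOn (fun x => x ^ E.crit * u x) (Icc r L) := by
    refine monotoneOn_of_hasDerivWithinAt_nonneg (convex_Icc r L) ?_
      (f' := fun x => E.crit * x ^ (E.crit - 1) * u x + x ^ E.crit * -(E.slope c u v x / x))
      (fun x hx => ?_) fun x hx => ?_
    · exact (continuousOn_id.rpow_const fun x _ => Or.inr E.crit_pos.le).mul (h.cont_u.mono hsub)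
    · rw [interior_Icc] at hx
      have hx0 : x ∈ Ioo 0 L := ⟨hr.trans hx.1, hx.2⟩
      exact ((Real.hasDerivAt_rpow_const (Or.inl hx0.1.ne')).mul
        (h.hasDerivAt_slope_div hx0)).hasDerivWithinAt
    · rw [interior_Icc] at hx
      have hxL : x ∈ Icc 0 L := hsub (Ioo_subset_Icc_self hx)
      have hx0 : 0 < x := hr.trans hx.1
      have h1 := h.antitoneOn_gap hc hxL ⟨h.L_nonneg, le_rfl⟩ hx.2.le
      have e : E.crit * x ^ (E.crit - 1) * u x + x ^ E.crit * -(E.slope c u v x / x)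
          = x ^ (E.crit - 1) * E.gap c u v x := by
        rw [Real.rpow_sub_one hx0.ne', RadialEqn.gap]; field_simp; ring
      rw [e]
      exact mul_nonneg (Real.rpow_nonneg hx0.le _) (hg.trans h1)
  exact hmono ⟨le_rfl, hrL⟩ ⟨hrL, le_rfl⟩ hrL

/-- The reaction terms are at most `1`, which limits the speed at which `u` falls. -/
lemma sub_le_of_le (h : IsSol E F c d L u v) (hc : 0 ≤ c) (hd : 0 ≤ d) (hr : 0 ≤ r)
    (hrr : r ≤ r') (hr' : r' ≤ L) :
    u r - c * (1 / E.A) ^ E.κ / (E.α + 1) * (r' ^ (E.α + 1) - r ^ (E.α + 1)) ≤ u r' := by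
  set C := c * (1 / E.A) ^ E.κ / (E.α + 1) with hC
  have hα := E.α_add_one_pos
  have hmono : MonotoneOn (fun x => u x + C * x ^ (E.α + 1)) (Icc 0 L) := by
    refine monotoneOn_of_hasDerivWithinAt_nonneg (convex_Icc 0 L) ?_
      (f' := fun x => -(c * (x ^ E.α * E.mean u v x ^ E.κ)) + C * ((E.α + 1) * x ^ E.α))
      (fun x hx => ?_) fun x hx => ?_
    · exact h.cont_u.add (continuousOn_const.mul
        (continuousOn_id.rpow_const fun x _ => Or.inr hα.le))
    · rw [interior_Icc] at hx
      have hp := Real.hasDerivAt_rpow_const (p := E.α + 1) (Or.inl hx.1.ne')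
      rw [add_sub_cancel_right] at hp
      exact ((h.hasDerivAt hx).add (hp.const_mul C)).hasDerivWithinAt
    · rw [interior_Icc] at hx
      have hxL := Ioo_subset_Icc_self hx
      have h' := h.mono hx.1.le hx.2.le
      have hm : E.mean u v x ≤ 1 / E.A := radialMean_le E.A_pos hx.1.le
        (E.continuousOn_force h'.cont_u h'.cont_v) fun y hy => E.force_le_one
          (h'.pos_u y hy).le (h'.pos_v y hy).le (h'.le_one hc hy) (h'.symm.le_one hd hy)
      have hpow := Real.rpow_le_rpow (h.mean_pos hxL).le hm E.κ_pos.le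
      have hx0 := Real.rpow_nonneg hx.1.le E.α
      have e : C * ((E.α + 1) * x ^ E.α) = c * (x ^ E.α * (1 / E.A) ^ E.κ) := by
        rw [hC]; field_simp
      rw [e]
      have := mul_le_mul_of_nonneg_left (mul_le_mul_of_nonneg_left hpow hx0) hc
      linarith
  have := hmono ⟨hr, hrr.trans hr'⟩ ⟨hr.trans hrr, hr'⟩ hrr
  simp only at this
  linarith

end IsSol

/-! ### Maximal solutions -/

/-- A positive solution on `[0, R)` that does not continue to `[0, R]`. -/
structure IsMaximalSol (E F : RadialEqn) (c d R : ℝ) (u v : ℝ → ℝ) : Prop where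
  R_pos : 0 < R
  isSol : ∀ L ∈ Ico 0 R, IsSol E F c d L u v
  lt_of_isSol : ∀ L u' v', IsSol E F c d L u' v' → L < R

section Maximal

variable {E F : RadialEqn} {c d R L r : ℝ} {u v u' v' : ℝ → ℝ}

lemma IsMaximalSol.symm (h : IsMaximalSol E F c d R u v) : IsMaximalSol F E d c R v u :=
  ⟨h.R_pos, fun L hL => (h.isSol L hL).symm, fun L u' v' h' => h.lt_of_isSol L v' u' h'.symm⟩

lemma exists_glued_isSol (E F : RadialEqn) (hc : 0 ≤ c) (hd : 0 ≤ d) :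
    ∃ u v, ∀ L u' v', IsSol E F c d L u' v' → IsSol E F c d L u v := by
  classical
  have key : ∀ r, ∃ w : ℝ × ℝ, ∀ u' v', IsSol E F c d r u' v' → u' r = w.1 ∧ v' r = w.2 := by
    intro r
    by_cases h : ∃ u v, IsSol E F c d r u v
    · obtain ⟨u, v, huv⟩ := h
      refine ⟨(u r, v r), fun u' v' h' => ?_⟩
      have := h'.eqOn huv hc hd
      exact ⟨this.1 ⟨huv.L_nonneg, le_rfl⟩, this.2 ⟨huv.L_nonneg, le_rfl⟩⟩
    · exact ⟨0, fun u' v' h' => (h ⟨u', v', h'⟩).elim⟩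
  choose w hw using key
  exact ⟨fun r => (w r).1, fun r => (w r).2, fun L u' v' h => h.congr
    (fun r hr => ((hw r u' v' (h.mono hr.1 hr.2)).1).symm)
    fun r hr => ((hw r u' v' (h.mono hr.1 hr.2)).2).symm⟩

lemma exists_global_or_maximal (E F : RadialEqn) (hc : 0 ≤ c) (hd : 0 ≤ d) :
    (∃ u v, ∀ L, 0 ≤ L → IsSol E F c d L u v) ∨ ∃ R u v, IsMaximalSol E F c d R u v := by
  obtain ⟨u, v, huv⟩ := exists_glued_isSol E F hc hd
  set S : Set ℝ := {L | IsSol E F c d L u v} with hS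
  have h0 : (0 : ℝ) ∈ S := huv 0 _ _ (isSol_zero E F c d)
  have hdown : ∀ L ∈ S, ∀ L', 0 ≤ L' → L' ≤ L → L' ∈ S := fun L hL L' h0 hle => hL.mono h0 hle
  by_cases hbdd : BddAbove S
  · right
    have hlt : ∀ L ∈ S, L < sSup S := fun L hL => by
      obtain ⟨L', u', v', hlt, h'⟩ := IsSol.exists_extension hL hc hd
      exact hlt.trans_le (le_csSup hbdd (huv L' u' v' h'))
    refine ⟨sSup S, u, v, hlt 0 h0, fun L hL => ?_, fun L u' v' h' => hlt L (huv L u' v' h')⟩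
    obtain ⟨L', hL', hlt'⟩ := exists_lt_of_lt_csSup ⟨0, h0⟩ hL.2
    exact hdown L' hL' L hL.1 hlt'.le
  · left
    refine ⟨u, v, fun L hL => ?_⟩
    obtain ⟨L', hL', hlt⟩ := not_bddAbove_iff.1 hbdd L
    exact hdown L' hL' L hL hlt.le

lemma IsMaximalSol.eq_of_isSol (h : IsMaximalSol E F c d R u v) (hc : 0 ≤ c) (hd : 0 ≤ d)
    (h' : IsSol E F c d L u' v') : EqOn u' u (Icc 0 L) ∧ EqOn v' v (Icc 0 L) :=
  h'.eqOn (h.isSol L ⟨h'.L_nonneg, h.lt_of_isSol L _ _ h'⟩) hc hd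

lemma IsMaximalSol.antitone (h : IsMaximalSol E F c d R u v) (hc : 0 ≤ c) :
    AntitoneOn u (Ico 0 R) := fun _ hx y hy hxy =>
  (h.isSol y hy).antitoneOn hc ⟨hx.1, hxy⟩ ⟨hy.1, le_rfl⟩ hxy

lemma IsMaximalSol.pos_u (h : IsMaximalSol E F c d R u v) (hr : r ∈ Ico 0 R) : 0 < u r :=
  (h.isSol r hr).pos_u r ⟨hr.1, le_rfl⟩

lemma IsMaximalSol.not_lower_bound (h : IsMaximalSol E F c d R u v) (hc : 0 ≤ c) (hd : 0 ≤ d)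
    {ε ε' : ℝ} (hε : 0 < ε) (hε' : 0 < ε') (hu : ∀ r ∈ Ico 0 R, ε ≤ u r)
    (hv : ∀ r ∈ Ico 0 R, ε' ≤ v r) : False := by
  obtain ⟨u', v', h'⟩ := exists_isSol_of_lower_bound hc hd h.R_pos (lt_min hε hε') fun r hr =>
    ⟨u, v, h.isSol r hr, (min_le_left _ _).trans (hu r hr), (min_le_right _ _).trans (hv r hr)⟩
  exact (h.lt_of_isSol R u' v' h').false

lemma IsMaximalSol.lower_bound_or_tendsto (h : IsMaximalSol E F c d R u v) (hc : 0 ≤ c) :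
    (∃ ε, 0 < ε ∧ ∀ r ∈ Ico 0 R, ε ≤ u r) ∨ Tendsto u (𝓝[<] R) (𝓝 0) := by
  by_cases hb : ∃ ε, 0 < ε ∧ ∀ r ∈ Ico 0 R, ε ≤ u r
  · exact Or.inl hb
  right
  push Not at hb
  rw [tendsto_order]
  constructor
  · intro a ha
    filter_upwards [Ioo_mem_nhdsLT h.R_pos] with r hr
    exact ha.trans (h.pos_u ⟨hr.1.le, hr.2⟩)
  · intro a ha
    obtain ⟨r, hr, hra⟩ := hb a ha
    filter_upwards [Ioo_mem_nhdsLT hr.2] with x hx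
    exact (h.antitone hc hr ⟨hr.1.trans hx.1.le, hx.2⟩ hx.1.le).trans_lt hra

/-- A lower bound for `u` that holds as long as the gap is nonnegative. -/
lemma IsMaximalSol.exists_lower_bound_of_gap_nonneg (h : IsMaximalSol E F c d R u v) (hc : 0 ≤ c)
    (hg : ∀ r ∈ Ioo 0 R, 0 ≤ E.gap c u v r) : ∃ ε, 0 < ε ∧ ∀ r ∈ Ico 0 R, ε ≤ u r := by
  have hR := h.R_pos
  have hr₀ : R / 2 ∈ Ico 0 R := ⟨by linarith, by linarith⟩
  have hRc := Real.rpow_pos_of_pos hR E.crit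
  have hrc := Real.rpow_pos_of_pos (half_pos hR) E.crit
  have hu₀ := h.pos_u hr₀
  have hlow : ∀ r ∈ Ico (R / 2) R, (R / 2) ^ E.crit * u (R / 2) / R ^ E.crit ≤ u r := fun r hr => by
    have hr' : r ∈ Ioo 0 R := ⟨by linarith [hr.1], hr.2⟩
    have h1 := (h.isSol r ⟨hr'.1.le, hr.2⟩).mul_rpow_le_of_gap_nonneg hc (half_pos hR) hr.1
      (hg r hr')
    rw [div_le_iff₀ hRc]
    refine h1.trans ?_
    rw [mul_comm]
    exact mul_le_mul_of_nonneg_left (Real.rpow_le_rpow hr'.1.le hr.2.le E.crit_pos.le)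
      (h.pos_u ⟨hr'.1.le, hr.2⟩).le
  refine ⟨_, div_pos (mul_pos hrc hu₀) hRc, fun r hr => ?_⟩
  rcases le_or_gt (R / 2) r with hr2 | hr2
  · exact hlow r ⟨hr2, hr.2⟩
  · exact (hlow _ ⟨le_rfl, hr₀.2⟩).trans (h.antitone hc hr hr₀ hr2.le)

lemma IsMaximalSol.exists_gap_neg (h : IsMaximalSol E F c d R u v) (hc : 0 ≤ c) (hd : 0 ≤ d) :
    ∃ r ∈ Ioo 0 R, E.gap c u v r < 0 ∨ F.gap d v u r < 0 := by
  by_contra! hcon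
  obtain ⟨ε, hε, hu⟩ := h.exists_lower_bound_of_gap_nonneg hc fun r hr => (hcon r hr).1
  obtain ⟨ε', hε', hv⟩ := h.symm.exists_lower_bound_of_gap_nonneg hd fun r hr => (hcon r hr).2
  exact h.not_lower_bound hc hd hε hε' hu hv

/-- A solution that stays positive for all radii has nonnegative gap: a negative gap would make it
decay logarithmically without bound. -/
lemma gap_nonneg_of_global (h : ∀ L, 0 ≤ L → IsSol E F c d L u v) (hc : 0 ≤ c) (hr : 0 ≤ r) :
    0 ≤ E.gap c u v r := by
  by_contra! hg
  have hr0 : 0 < r := by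
    rcases hr.eq_or_lt with rfl | h0
    · rw [(h 0 le_rfl).gap_zero] at hg
      exact (hg.not_gt E.crit_pos).elim
    · exact h0
  have hu : 0 < u r := (h r hr).pos_u r ⟨hr, le_rfl⟩
  have hq : 0 ≤ u r / -E.gap c u v r := div_nonneg hu.le (by linarith)
  set r' := r * Real.exp (u r / -E.gap c u v r) with hr'
  have hrr : r ≤ r' := le_mul_of_one_le_right hr (Real.one_le_exp hq)
  have h1 := (h r' (hr.trans hrr)).le_add_gap_mul_log hc hr0 hrr le_rfl
  have e : r' / r = Real.exp (u r / -E.gap c u v r) := by rw [hr']; field_simp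
  rw [e, Real.log_exp] at h1
  have e2 : E.gap c u v r * (u r / -E.gap c u v r) = -u r := by
    have := hg.ne
    field_simp
  rw [e2, add_neg_cancel] at h1
  exact h1.not_gt ((h r' (hr.trans hrr)).pos_u r' ⟨hr.trans hrr, le_rfl⟩)

lemma IsSol.eq_one (h : IsSol E F 0 d L u v) (hr : r ∈ Icc 0 L) : u r = 1 := by
  rw [h.eq_u r hr, zero_mul, sub_zero]

lemma IsSol.gap_pos_of_eq_zero (h : IsSol E F 0 d L u v) (hr : r ∈ Icc 0 L) :
    0 < E.gap 0 u v r := by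
  rw [RadialEqn.gap, RadialEqn.slope, zero_mul, sub_zero]
  exact mul_pos E.crit_pos (h.pos_u r hr)

end Maximal

/-! ### Shooting for a simultaneous crossing -/

section Crossing

variable {E F : RadialEqn} {c d : ℝ → ℝ}

/-- The parameters for which the gap of `u` has become negative at some radius where the gap of `v` is
still positive. -/
def crossesFirst (E F : RadialEqn) (c d : ℝ → ℝ) : Set ℝ :=
  {θ | ∃ r u v, IsSol E F (c θ) (d θ) r u v ∧ E.gap (c θ) u v r < 0 ∧ 0 < F.gap (d θ) v u r}

lemma isOpen_crossesFirst (hc : Continuous c) (hd : Continuous d) (hc0 : ∀ θ, 0 ≤ c θ)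
    (hd0 : ∀ θ, 0 ≤ d θ) : IsOpen (crossesFirst E F c d) := by
  rw [isOpen_iff_mem_nhds]
  rintro θ₀ ⟨r, u, v, h, hu, hv⟩
  obtain ⟨us, vs, hs, hus, hvs, hm, hm'⟩ := h.exists_perturbation hc hd hc0 hd0
  have h1 : Tendsto (fun θ => E.gap (c θ) (us θ) (vs θ) r) (𝓝 θ₀) (𝓝 (E.gap (c θ₀) u v r)) :=
    (hus.const_mul _).sub ((hc.tendsto θ₀).mul (hm.const_mul _))
  have h2 : Tendsto (fun θ => F.gap (d θ) (vs θ) (us θ) r) (𝓝 θ₀) (𝓝 (F.gap (d θ₀) v u r)) :=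
    (hvs.const_mul _).sub ((hd.tendsto θ₀).mul (hm'.const_mul _))
  filter_upwards [hs, h1.eventually (gt_mem_nhds hu), h2.eventually (lt_mem_nhds hv)]
    with θ a b e
  exact ⟨r, us θ, vs θ, a, b, e⟩

lemma disjoint_crossesFirst (hc0 : ∀ θ, 0 ≤ c θ) (hd0 : ∀ θ, 0 ≤ d θ) :
    Disjoint (crossesFirst E F c d) (crossesFirst F E d c) := by
  have key : ∀ (E F : RadialEqn) (c d r r' : ℝ) (u v u' v' : ℝ → ℝ), 0 ≤ c → 0 ≤ d →
      IsSol E F c d r u v → IsSol E F c d r' u' v' → r ≤ r' → E.gap c u v r < 0 →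
      0 < E.gap c u' v' r' → False := by
    intro E F c d r r' u v u' v' hc hd h h' hrr hg hg'
    have heq := (h'.mono h.L_nonneg hrr).eqOn h hc hd
    have h1 := h'.antitoneOn_gap hc ⟨h.L_nonneg, hrr⟩ ⟨h'.L_nonneg, le_rfl⟩ hrr
    have h2 : E.gap c u' v' r = E.gap c u v r := by
      rw [RadialEqn.gap, RadialEqn.slope, heq.1 ⟨h.L_nonneg, le_rfl⟩,
        E.mean_congr h.L_nonneg heq.1 heq.2]
      rfl
    linarith
  rw [Set.disjoint_left]
  rintro θ ⟨r, u, v, h, hu, hv⟩ ⟨r', v', u', h', hv', hu'⟩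
  rcases le_total r r' with hrr | hrr
  · exact key E F _ _ r r' u v u' v' (hc0 θ) (hd0 θ) h h'.symm hrr hu hu'
  · exact key F E _ _ r' r v' u' v u (hd0 θ) (hc0 θ) h' h.symm hrr hv' hv

lemma exists_common_zero_of_gap_neg {E F : RadialEqn} {c d r : ℝ} {u v : ℝ → ℝ}
    (h : IsSol E F c d r u v) (hc : 0 ≤ c) (hd : 0 ≤ d) (hr : E.gap c u v r < 0)
    (hE : ∀ x ∈ Icc 0 r, E.gap c u v x < 0 → F.gap d v u x ≤ 0)
    (hF : ∀ x ∈ Icc 0 r, F.gap d v u x < 0 → E.gap c u v x ≤ 0) :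
    0 < c ∧ 0 < d ∧ ∃ x ∈ Ioo 0 r, E.gap c u v x = 0 ∧ F.gap d v u x = 0 := by
  have hr0 := h.L_nonneg
  have hrr : r ∈ Icc 0 r := ⟨hr0, le_rfl⟩
  have hc' : 0 < c := hc.lt_of_ne' fun h0 => by
    subst h0; exact hr.not_gt (h.gap_pos_of_eq_zero hrr)
  have hFr := hE r hrr hr
  have hd' : 0 < d := hd.lt_of_ne' fun h0 => by
    subst h0; exact hFr.not_gt (h.symm.gap_pos_of_eq_zero hrr)
  have hg0 := h.gap_zero
  have hg0' := h.symm.gap_zero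
  obtain ⟨x, hx, hx0⟩ := intermediate_value_Icc' hr0 h.continuousOn_gap
    (show (0 : ℝ) ∈ Icc (E.gap c u v r) (E.gap c u v 0) from ⟨hr.le, hg0 ▸ E.crit_pos.le⟩)
  obtain ⟨y, hy, hy0⟩ := intermediate_value_Icc' hr0 h.symm.continuousOn_gap
    (show (0 : ℝ) ∈ Icc (F.gap d v u r) (F.gap d v u 0) from ⟨hFr, hg0' ▸ F.crit_pos.le⟩)
  have hx1 : 0 < x := hx.1.lt_of_ne fun h0 => by
    rw [← h0, hg0] at hx0; exact E.crit_pos.ne' hx0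
  have hx2 : x < r := hx.2.lt_of_ne fun h0 => by rw [h0] at hx0; exact hr.ne hx0
  have hxy : x = y := by
    -- Between two different zeros the gaps would have opposite strict signs.
    rcases lt_trichotomy x y with hlt | heq | hlt
    · have hm : (x + y) / 2 ∈ Icc 0 r := ⟨by linarith, by linarith [hy.2]⟩
      have h1 := h.strictAntiOn_gap hc' hx hm (by linarith)
      have h2 := h.symm.strictAntiOn_gap hd' hm hy (by linarith)
      linarith [hE _ hm (by linarith)]
    · exact heq
    · have hm : (x + y) / 2 ∈ Icc 0 r := ⟨by linarith [hy.1], by linarith⟩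
      have h1 := h.symm.strictAntiOn_gap hd' hy hm (by linarith)
      have h2 := h.strictAntiOn_gap hc' hm hx (by linarith)
      linarith [hF _ hm (by linarith)]
  exact ⟨hc', hd', x, ⟨hx1, hx2⟩, hx0, hxy ▸ hy0⟩

/-- If no parameter gives a solution for all radii, then for some parameter both gaps vanish at the
same radius. -/
lemma exists_simultaneous_crossing (E F : RadialEqn)
    (hno : ∀ θ ∈ Icc (0 : ℝ) 1, ¬ ∃ u v, ∀ L, 0 ≤ L → IsSol E F |1 - θ| |θ| L u v) :
    ∃ c d R u v, 0 < c ∧ 0 < d ∧ IsMaximalSol E F c d R u v ∧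
      ∃ r ∈ Ioo 0 R, E.gap c u v r = 0 ∧ F.gap d v u r = 0 := by
  set c : ℝ → ℝ := fun θ => |1 - θ| with hc_def
  set d : ℝ → ℝ := fun θ => |θ| with hd_def
  have hc : Continuous c := by fun_prop
  have hd : Continuous d := by fun_prop
  have hc0 : ∀ θ, 0 ≤ c θ := fun _ => abs_nonneg _
  have hd0 : ∀ θ, 0 ≤ d θ := fun _ => abs_nonneg _
  have hmax : ∀ θ ∈ Icc (0 : ℝ) 1, ∃ R u v, IsMaximalSol E F (c θ) (d θ) R u v := fun θ hθ =>
    (exists_global_or_maximal E F (hc0 θ) (hd0 θ)).resolve_left (hno θ hθ)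
  have hzero : (0 : ℝ) ∈ crossesFirst E F c d := by
    obtain ⟨R, u, v, h⟩ := hmax 0 ⟨le_rfl, zero_le_one⟩
    obtain ⟨r, hr, hneg⟩ := h.exists_gap_neg (hc0 0) (hd0 0)
    have hs := h.isSol r ⟨hr.1.le, hr.2⟩
    have hpos : 0 < F.gap (d 0) v u r := by
      have e : d 0 = 0 := by simp [hd_def]
      rw [e] at hs ⊢
      exact hs.symm.gap_pos_of_eq_zero ⟨hr.1.le, le_rfl⟩
    exact ⟨r, u, v, hs, hneg.resolve_right hpos.not_gt, hpos⟩
  have hone : (1 : ℝ) ∈ crossesFirst F E d c := by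
    obtain ⟨R, u, v, h⟩ := hmax 1 ⟨zero_le_one, le_rfl⟩
    obtain ⟨r, hr, hneg⟩ := h.exists_gap_neg (hc0 1) (hd0 1)
    have hs := h.isSol r ⟨hr.1.le, hr.2⟩
    have hpos : 0 < E.gap (c 1) u v r := by
      have e : c 1 = 0 := by simp [hc_def]
      rw [e] at hs ⊢
      exact hs.gap_pos_of_eq_zero ⟨hr.1.le, le_rfl⟩
    exact ⟨r, v, u, hs.symm, hneg.resolve_left hpos.not_gt, hpos⟩
  obtain ⟨θ, hθ, hnot⟩ : ∃ θ ∈ Icc (0 : ℝ) 1,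
      θ ∉ crossesFirst E F c d ∪ crossesFirst F E d c := by
    by_contra! hcon
    obtain ⟨θ, -, h1, h2⟩ := isPreconnected_Icc _ _ (isOpen_crossesFirst hc hd hc0 hd0)
      (isOpen_crossesFirst hd hc hd0 hc0) hcon ⟨0, ⟨le_rfl, zero_le_one⟩, hzero⟩
      ⟨1, ⟨zero_le_one, le_rfl⟩, hone⟩
    exact Set.disjoint_left.1 (disjoint_crossesFirst hc0 hd0) h1 h2
  obtain ⟨R, u, v, h⟩ := hmax θ hθ
  have hE : ∀ x ∈ Ico 0 R, E.gap (c θ) u v x < 0 → F.gap (d θ) v u x ≤ 0 := fun x hx hx0 => by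
    by_contra! hp
    exact hnot (Or.inl ⟨x, u, v, h.isSol x hx, hx0, hp⟩)
  have hF : ∀ x ∈ Ico 0 R, F.gap (d θ) v u x < 0 → E.gap (c θ) u v x ≤ 0 := fun x hx hx0 => by
    by_contra! hp
    exact hnot (Or.inr ⟨x, v, u, (h.isSol x hx).symm, hx0, hp⟩)
  obtain ⟨r, hr, hneg | hneg⟩ := h.exists_gap_neg (hc0 θ) (hd0 θ)
  · have hsub : Icc 0 r ⊆ Ico 0 R := fun x hx => ⟨hx.1, hx.2.trans_lt hr.2⟩
    obtain ⟨h1, h2, x, hx, hx1, hx2⟩ := exists_common_zero_of_gap_neg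
      (h.isSol r ⟨hr.1.le, hr.2⟩) (hc0 θ) (hd0 θ) hneg (fun x hx => hE x (hsub hx))
      fun x hx => hF x (hsub hx)
    exact ⟨c θ, d θ, R, u, v, h1, h2, h, x, ⟨hx.1, hx.2.trans hr.2⟩, hx1, hx2⟩
  · have hsub : Icc 0 r ⊆ Ico 0 R := fun x hx => ⟨hx.1, hx.2.trans_lt hr.2⟩
    obtain ⟨h1, h2, x, hx, hx1, hx2⟩ := exists_common_zero_of_gap_neg
      (h.isSol r ⟨hr.1.le, hr.2⟩).symm (hd0 θ) (hc0 θ) hneg (fun x hx => hF x (hsub hx))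
      fun x hx => hE x (hsub hx)
    exact ⟨c θ, d θ, R, u, v, h2, h1, h, x, ⟨hx.1, hx.2.trans hr.2⟩, hx2, hx1⟩

end Crossing

/-! ### Shooting for a simultaneous zero -/

section Vanishing

variable {E F : RadialEqn} {c d : ℝ → ℝ}

/-- The parameters for which, at some radius `r`, the decay of `u` is so fast that `u` vanishes before
a radius `r'` up to which `v` is bound to stay positive. The condition involves only the values of the
solution at `r`, which makes it open. -/
def vanishesFirst (E F : RadialEqn) (c d : ℝ → ℝ) : Set ℝ :=
  {θ | ∃ r r' u v, 0 < r ∧ r ≤ r' ∧ IsSol E F (c θ) (d θ) r u v ∧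
    u r + E.gap (c θ) u v r * Real.log (r' / r) < 0 ∧
    d θ * (1 / F.A) ^ F.κ / (F.α + 1) * (r' ^ (F.α + 1) - r ^ (F.α + 1)) < v r}

lemma isOpen_vanishesFirst (hc : Continuous c) (hd : Continuous d) (hc0 : ∀ θ, 0 ≤ c θ)
    (hd0 : ∀ θ, 0 ≤ d θ) : IsOpen (vanishesFirst E F c d) := by
  rw [isOpen_iff_mem_nhds]
  rintro θ₀ ⟨r, r', u, v, hr, hrr, h, hu, hv⟩
  obtain ⟨us, vs, hs, hus, hvs, hm, -⟩ := h.exists_perturbation hc hd hc0 hd0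
  have h1 : Tendsto (fun θ => us θ r + E.gap (c θ) (us θ) (vs θ) r * Real.log (r' / r)) (𝓝 θ₀)
      (𝓝 (u r + E.gap (c θ₀) u v r * Real.log (r' / r))) :=
    hus.add (((hus.const_mul _).sub ((hc.tendsto θ₀).mul (hm.const_mul _))).mul_const _)
  have h2 : Tendsto (fun θ => d θ * (1 / F.A) ^ F.κ / (F.α + 1)
      * (r' ^ (F.α + 1) - r ^ (F.α + 1))) (𝓝 θ₀)
      (𝓝 (d θ₀ * (1 / F.A) ^ F.κ / (F.α + 1) * (r' ^ (F.α + 1) - r ^ (F.α + 1)))) :=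
    (((hd.tendsto θ₀).mul_const _).div_const _).mul_const _
  filter_upwards [hs, h1.eventually (gt_mem_nhds hu), h2.eventually_lt hvs hv] with θ a b e
  exact ⟨r, r', us θ, vs θ, hr, hrr, a, b, e⟩

lemma IsMaximalSol.exists_lower_bound_of_vanishesFirst {R θ : ℝ} {u v : ℝ → ℝ}
    (h : IsMaximalSol E F (c θ) (d θ) R u v) (hc0 : 0 ≤ c θ) (hd0 : 0 ≤ d θ)
    (hθ : θ ∈ vanishesFirst E F c d) : ∃ ε, 0 < ε ∧ ∀ r ∈ Ico 0 R, ε ≤ v r := by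
  obtain ⟨r, r', u', v', hr, hrr, h', hu, hv⟩ := hθ
  have hrR := h.lt_of_isSol r u' v' h'
  have heq := h.eq_of_isSol hc0 hd0 h'
  have hr0 : r ∈ Icc 0 r := ⟨hr.le, le_rfl⟩
  have hgap : E.gap (c θ) u' v' r = E.gap (c θ) u v r := by
    rw [RadialEqn.gap, RadialEqn.slope, heq.1 hr0, E.mean_congr hr.le heq.1 heq.2]
    rfl
  rw [hgap, heq.1 hr0] at hu
  rw [heq.2 hr0] at hv
  have hRr : R ≤ r' := by
    by_contra! hlt
    have hs := h.isSol r' ⟨hr.le.trans hrr, hlt⟩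
    have h1 := hs.le_add_gap_mul_log hc0 hr hrr le_rfl
    have h2 := hs.pos_u r' ⟨hr.le.trans hrr, le_rfl⟩
    linarith
  set C := d θ * (1 / F.A) ^ F.κ / (F.α + 1) with hC
  have hC0 : 0 ≤ C := div_nonneg (mul_nonneg hd0 (Real.rpow_nonneg
    (one_div_nonneg.2 F.A_pos.le) _)) F.α_add_one_pos.le
  have hlow : ∀ x ∈ Ico r R, v r - C * (r' ^ (F.α + 1) - r ^ (F.α + 1)) ≤ v x := fun x hx => by
    have h1 := (h.isSol x ⟨hr.le.trans hx.1, hx.2⟩).symm.sub_le_of_le hd0 hc0 hr.le hx.1 le_rfl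
    have h2 : x ^ (F.α + 1) ≤ r' ^ (F.α + 1) :=
      Real.rpow_le_rpow (hr.le.trans hx.1) (hx.2.le.trans hRr) F.α_add_one_pos.le
    have h3 := mul_le_mul_of_nonneg_left (sub_le_sub_right h2 (r ^ (F.α + 1))) hC0
    linarith
  refine ⟨_, sub_pos.2 hv, fun x hx => ?_⟩
  rcases le_or_gt r x with hrx | hrx
  · exact hlow x ⟨hrx, hx.2⟩
  · exact (hlow r ⟨le_rfl, hrR⟩).trans (h.symm.antitone hd0 hx ⟨hr.le, hrR⟩ hrx.le)

lemma IsMaximalSol.mem_vanishesFirst {R θ ε : ℝ} {u v : ℝ → ℝ}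
    (h : IsMaximalSol E F (c θ) (d θ) R u v) (hc0 : 0 ≤ c θ)
    (hu : Tendsto u (𝓝[<] R) (𝓝 0)) (hε : 0 < ε) (hv : ∀ r ∈ Ico 0 R, ε ≤ v r) :
    θ ∈ vanishesFirst E F c d := by
  have hR := h.R_pos
  have hcpos : 0 < c θ := hc0.lt_of_ne' fun h0 => by
    have h1 : Tendsto u (𝓝[<] R) (𝓝 1) := by
      refine tendsto_const_nhds.congr' ?_
      filter_upwards [Ioo_mem_nhdsLT hR] with r hr
      have hs := h.isSol r ⟨hr.1.le, hr.2⟩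
      rw [h0] at hs
      exact (hs.eq_one ⟨hr.1.le, le_rfl⟩).symm
    exact zero_ne_one (tendsto_nhds_unique hu h1)
  set C := d θ * (1 / F.A) ^ F.κ / (F.α + 1) with hC
  -- The radius `r'` lies beyond `R`, but so close that `v` cannot lose more than `ε` on the way.
  obtain ⟨r', hr'R, hr'⟩ : ∃ r', R < r' ∧ C * (r' ^ (F.α + 1) - R ^ (F.α + 1)) < ε := by
    have hcont : ContinuousAt (fun x : ℝ => C * (x ^ (F.α + 1) - R ^ (F.α + 1))) R :=
      continuousAt_const.mul ((Real.continuousAt_rpow_const R _ (Or.inl hR.ne')).sub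
        continuousAt_const)
    have hev : ∀ᶠ x in 𝓝[>] R, C * (x ^ (F.α + 1) - R ^ (F.α + 1)) < ε :=
      (hcont.tendsto.mono_left nhdsWithin_le_nhds).eventually (gt_mem_nhds (by simpa using hε))
    obtain ⟨x, hx1, hx2⟩ := (hev.and self_mem_nhdsWithin).exists
    exact ⟨x, hx2, hx1⟩
  have hev1 : ∀ᶠ r in 𝓝[<] R, C * (r' ^ (F.α + 1) - r ^ (F.α + 1)) < ε := by
    have hcont : ContinuousAt (fun x : ℝ => C * (r' ^ (F.α + 1) - x ^ (F.α + 1))) R :=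
      continuousAt_const.mul (continuousAt_const.sub
        (Real.continuousAt_rpow_const R _ (Or.inl hR.ne')))
    exact (hcont.tendsto.mono_left nhdsWithin_le_nhds).eventually (gt_mem_nhds hr')
  have hr₀ : R / 2 ∈ Ioo 0 R := ⟨by linarith, by linarith⟩
  set k := (R / 2) ^ E.crit * E.slope (c θ) u v (R / 2) / R ^ E.crit with hk
  have hRc := Real.rpow_pos_of_pos hR E.crit
  have hk0 : 0 < k := div_pos (mul_pos (Real.rpow_pos_of_pos hr₀.1 _)
    ((h.isSol _ ⟨hr₀.1.le, hr₀.2⟩).slope_pos hcpos ⟨hr₀.1, le_rfl⟩)) hRc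
  have hslope : ∀ r ∈ Ico (R / 2) R, k ≤ E.slope (c θ) u v r := fun r hr => by
    have hr0 : 0 < r := hr₀.1.trans_le hr.1
    have hs := h.isSol r ⟨hr0.le, hr.2⟩
    rw [hk, div_le_iff₀ hRc, mul_comm _ (R ^ E.crit)]
    refine (hs.slope_mul_rpow_le hc0 hr₀.1 hr.1 le_rfl).trans ?_
    exact mul_le_mul_of_nonneg_right (Real.rpow_le_rpow hr0.le hr.2.le E.crit_pos.le)
      (hs.slope_nonneg hc0 ⟨hr0.le, le_rfl⟩)
  set l := Real.log (r' / R) with hl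
  have hl0 : 0 < l := Real.log_pos ((one_lt_div hR).2 hr'R)
  have hev2 : ∀ᶠ r in 𝓝[<] R,
      u r + E.crit * u r * Real.log (r' / (R / 2)) - k * l < 0 := by
    have hlim : Tendsto (fun r => u r + E.crit * u r * Real.log (r' / (R / 2)) - k * l) (𝓝[<] R)
        (𝓝 (0 + E.crit * 0 * Real.log (r' / (R / 2)) - k * l)) :=
      (hu.add ((hu.const_mul _).mul_const _)).sub_const _
    refine hlim.eventually (gt_mem_nhds ?_)
    have := mul_pos hk0 hl0
    linarith
  obtain ⟨r, h1, h2, hr⟩ := (hev1.and (hev2.and (Ioo_mem_nhdsLT hr₀.2))).exists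
  have hr0 : 0 < r := hr₀.1.trans hr.1
  have hrr' : r < r' := hr.2.trans hr'R
  have hrR : r ∈ Ico 0 R := ⟨hr0.le, hr.2⟩
  refine ⟨r, r', u, v, hr0, hrr'.le, h.isSol r hrR, ?_, h1.trans_le (hv r hrR)⟩
  have hu0 := h.pos_u hrR
  have hlog1 : l ≤ Real.log (r' / r) :=
    Real.log_le_log (by have := hR.trans hr'R; positivity)
      (div_le_div_of_nonneg_left (hr0.trans hrr').le hr0 hr.2.le)
  have hlog2 : Real.log (r' / r) ≤ Real.log (r' / (R / 2)) :=
    Real.log_le_log (div_pos (hr0.trans hrr') hr0)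
      (div_le_div_of_nonneg_left (hr0.trans hrr').le hr₀.1 hr.1.le)
  have t1 : E.crit * u r * Real.log (r' / r) ≤ E.crit * u r * Real.log (r' / (R / 2)) :=
    mul_le_mul_of_nonneg_left hlog2 (mul_pos E.crit_pos hu0).le
  have t2 : k * l ≤ E.slope (c θ) u v r * Real.log (r' / r) :=
    mul_le_mul (hslope r ⟨hr.1.le, hr.2⟩) hlog1 hl0.le (hk0.le.trans (hslope r ⟨hr.1.le, hr.2⟩))
  rw [RadialEqn.gap, sub_mul]
  linarith

/-- If no parameter gives a solution for all radii, then for some parameter both unknowns vanish at the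
end of the maximal interval. -/
lemma exists_simultaneous_zero (E F : RadialEqn)
    (hno : ∀ θ ∈ Icc (0 : ℝ) 1, ¬ ∃ u v, ∀ L, 0 ≤ L → IsSol E F |1 - θ| |θ| L u v) :
    ∃ c d R u v, 0 < c ∧ 0 < d ∧ IsMaximalSol E F c d R u v ∧
      Tendsto u (𝓝[<] R) (𝓝 0) ∧ Tendsto v (𝓝[<] R) (𝓝 0) := by
  set c : ℝ → ℝ := fun θ => |1 - θ| with hc_def
  set d : ℝ → ℝ := fun θ => |θ| with hd_def
  have hc : Continuous c := by fun_prop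
  have hd : Continuous d := by fun_prop
  have hc0 : ∀ θ, 0 ≤ c θ := fun _ => abs_nonneg _
  have hd0 : ∀ θ, 0 ≤ d θ := fun _ => abs_nonneg _
  have hmax : ∀ θ ∈ Icc (0 : ℝ) 1, ∃ R u v, IsMaximalSol E F (c θ) (d θ) R u v := fun θ hθ =>
    (exists_global_or_maximal E F (hc0 θ) (hd0 θ)).resolve_left (hno θ hθ)
  have hone_of : ∀ {E F : RadialEqn} {c R : ℝ} {u v : ℝ → ℝ}, IsMaximalSol E F c 0 R u v →
      ∀ r ∈ Ico 0 R, 1 ≤ v r := fun h r hr =>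
    ((h.isSol r hr).symm.eq_one ⟨hr.1, le_rfl⟩).ge
  have hzero : (0 : ℝ) ∈ vanishesFirst E F c d := by
    obtain ⟨R, u, v, h⟩ := hmax 0 ⟨le_rfl, zero_le_one⟩
    have hv : ∀ r ∈ Ico 0 R, 1 ≤ v r := hone_of (by simpa [hd_def] using h)
    refine h.mem_vanishesFirst (hc0 0) ?_ one_pos hv
    refine (h.lower_bound_or_tendsto (hc0 0)).resolve_left fun ⟨ε, hε, hu⟩ => ?_
    exact h.not_lower_bound (hc0 0) (hd0 0) hε one_pos hu hv
  have hone : (1 : ℝ) ∈ vanishesFirst F E d c := by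
    obtain ⟨R, u, v, h⟩ := hmax 1 ⟨zero_le_one, le_rfl⟩
    have hu : ∀ r ∈ Ico 0 R, 1 ≤ u r := hone_of (E := F) (by simpa [hc_def] using h.symm)
    refine h.symm.mem_vanishesFirst (hd0 1) ?_ one_pos hu
    refine (h.symm.lower_bound_or_tendsto (hd0 1)).resolve_left fun ⟨ε, hε, hv⟩ => ?_
    exact h.not_lower_bound (hc0 1) (hd0 1) one_pos hε hu hv
  obtain ⟨θ, hθ, hnot⟩ : ∃ θ ∈ Icc (0 : ℝ) 1,
      θ ∉ vanishesFirst E F c d ∪ vanishesFirst F E d c := by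
    by_contra! hcon
    obtain ⟨θ, hθ, h1, h2⟩ := isPreconnected_Icc _ _ (isOpen_vanishesFirst hc hd hc0 hd0)
      (isOpen_vanishesFirst hd hc hd0 hc0) hcon ⟨0, ⟨le_rfl, zero_le_one⟩, hzero⟩
      ⟨1, ⟨zero_le_one, le_rfl⟩, hone⟩
    obtain ⟨R, u, v, h⟩ := hmax θ hθ
    obtain ⟨ε, hε, hv⟩ := h.exists_lower_bound_of_vanishesFirst (hc0 θ) (hd0 θ) h1
    obtain ⟨ε', hε', hu⟩ := h.symm.exists_lower_bound_of_vanishesFirst (hd0 θ) (hc0 θ) h2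
    exact h.not_lower_bound (hc0 θ) (hd0 θ) hε' hε hu hv
  obtain ⟨R, u, v, h⟩ := hmax θ hθ
  have hlim : Tendsto u (𝓝[<] R) (𝓝 0) ∧ Tendsto v (𝓝[<] R) (𝓝 0) := by
    rcases h.lower_bound_or_tendsto (hc0 θ) with ⟨ε, hε, hu⟩ | hu <;>
      rcases h.symm.lower_bound_or_tendsto (hd0 θ) with ⟨ε', hε', hv⟩ | hv
    · exact (h.not_lower_bound (hc0 θ) (hd0 θ) hε hε' hu hv).elim
    · exact (hnot (Or.inr (h.symm.mem_vanishesFirst (hd0 θ) hv hε hu))).elim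
    · exact (hnot (Or.inl (h.mem_vanishesFirst (hc0 θ) hu hε' hv))).elim
    · exact ⟨hu, hv⟩
  have hpos : ∀ {E F : RadialEqn} {c d : ℝ} {u v : ℝ → ℝ}, 0 ≤ d → IsMaximalSol E F c d R u v →
      Tendsto v (𝓝[<] R) (𝓝 0) → 0 < d := by
    intro E F c d u v hd0 h hv
    refine hd0.lt_of_ne' fun h0 => ?_
    subst h0
    obtain ⟨r, h1, hr⟩ := ((hv.eventually (gt_mem_nhds one_pos)).and
      (Ioo_mem_nhdsLT h.R_pos)).exists
    exact h1.not_ge (hone_of h r ⟨hr.1.le, hr.2⟩)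
  exact ⟨c θ, d θ, R, u, v, hpos (hc0 θ) h.symm hlim.1, hpos (hd0 θ) h hlim.2, h, hlim.1, hlim.2⟩

end Vanishing

/-! ### The scalar equation: the Pohozaev identity -/

section Pohozaev

variable {E F : RadialEqn} {L r : ℝ} {u v : ℝ → ℝ}

/-- The Pohozaev function of the scalar equation `d = 0`, where `v = 1`. -/
noncomputable def pohozaev (E : RadialEqn) (u v : ℝ → ℝ) (r : ℝ) : ℝ :=
  r ^ E.A * (r ^ (E.α + 1) * E.mean u v r ^ (E.κ + 1) / (E.κ + 1) + u r ^ (E.s + 1) / (E.s + 1)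
    - E.crit / (E.κ + 1) * (E.mean u v r * u r))

lemma pohozaev_zero : pohozaev E u v 0 = 0 := by
  rw [pohozaev, Real.zero_rpow E.A_pos.ne', zero_mul]

lemma continuousOn_pohozaev (h : IsSol E F 1 0 L u v) :
    ContinuousOn (pohozaev E u v) (Icc 0 L) := by
  have hm := E.continuousOn_mean h.cont_u h.cont_v
  have hκ := E.κ_pos
  have hs := E.s_nonneg
  have h1 : ∀ {e : ℝ}, 0 ≤ e → ContinuousOn (fun x : ℝ => x ^ e) (Icc 0 L) := fun he =>
    continuousOn_id.rpow_const fun _ _ => Or.inr he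
  exact (h1 E.A_pos.le).mul (((((h1 E.α_add_one_pos.le).mul
    (hm.rpow_const fun _ _ => Or.inr (by linarith))).div_const _).add
    ((h.cont_u.rpow_const fun _ _ => Or.inr (by linarith)).div_const _)).sub
    ((hm.mul h.cont_u).const_mul _))

lemma hasDerivAt_pohozaev (h : IsSol E F 1 0 L u v) (hr : r ∈ Ioo 0 L) :
    HasDerivAt (pohozaev E u v)
      ((E.A / (E.s + 1) - E.crit / (E.κ + 1)) * (r ^ (E.A - 1) * u r ^ (E.s + 1))) r := by
  set M : ℝ → ℝ := fun x => ∫ σ in (0 : ℝ)..x, σ ^ (E.A - 1) * E.force u v σ with hM_def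
  have hrL : r ∈ Ioc 0 L := Ioo_subset_Ioc_self hr
  have hr0 : r ≠ 0 := hr.1.ne'
  have hu0 := h.pos_u r (Ioo_subset_Icc_self hr)
  have hM0 : 0 < M r := h.mass_pos hrL
  have hκ : E.κ + 1 ≠ 0 := by linarith [E.κ_pos]
  have hs : E.s + 1 ≠ 0 := by linarith [E.s_nonneg]
  have hforce : E.force u v r = u r ^ E.s := by
    rw [RadialEqn.force, h.symm.eq_one (Ioo_subset_Icc_self hr), Real.one_rpow, mul_one]
  have hM : HasDerivAt M (r ^ (E.A - 1) * u r ^ E.s) r := hforce ▸ h.hasDerivAt_mass hr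
  have hu : HasDerivAt u (-(r ^ (-E.crit) * M r ^ E.κ / r)) r := by
    have := h.hasDerivAt_slope_div hr
    rwa [h.slope_eq hrL, one_mul] at this
  -- In terms of the mass `M = r ^ A * mean` the Pohozaev function has only polynomial terms.
  have hev : pohozaev E u v =ᶠ[𝓝 r] fun x => M x ^ (E.κ + 1) * x ^ (-E.crit) / (E.κ + 1)
      + x ^ E.A * (u x ^ (E.s + 1) / (E.s + 1)) - E.crit / (E.κ + 1) * (M x * u x) := by
    filter_upwards [Ioo_mem_nhds hr.1 hr.2] with x hx
    have hMx : M x = x ^ E.A * E.mean u v x := (rpow_mul_radialMean hx.1).symm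
    have e : x ^ E.A * x ^ (E.α + 1) = x ^ (E.A * (E.κ + 1)) * x ^ (-E.crit) := by
      rw [← Real.rpow_add hx.1, ← Real.rpow_add hx.1]
      congr 1
      unfold RadialEqn.crit
      ring
    rw [hMx, Real.mul_rpow (Real.rpow_nonneg hx.1.le _)
      (h.mean_pos (Ioo_subset_Icc_self hx)).le, ← Real.rpow_mul hx.1.le, pohozaev]
    linear_combination (E.mean u v x ^ (E.κ + 1) / (E.κ + 1)) * e
  refine HasDerivAt.congr_of_eventuallyEq ?_ hev
  have d1 := hM.rpow_const (p := E.κ + 1) (Or.inl hM0.ne')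
  have d2 := Real.hasDerivAt_rpow_const (p := -E.crit) (Or.inl hr0)
  have d3 := Real.hasDerivAt_rpow_const (p := E.A) (Or.inl hr0)
  have d4 := hu.rpow_const (p := E.s + 1) (Or.inl hu0.ne')
  refine ((((d1.mul d2).div_const _).add (d3.mul (d4.div_const _))).sub
    ((hM.mul hu).const_mul _)).congr_deriv ?_
  rw [add_sub_cancel_right, add_sub_cancel_right, Real.rpow_add_one hM0.ne',
    Real.rpow_add_one hu0.ne', Real.rpow_sub_one hr0, Real.rpow_sub_one hr0]
  field_simp
  ring

/-- In the subcritical range the scalar equation has no positive solution for all radii: the Pohozaev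
function is increasing, which bounds `u` from below by a power of `r`, while nonnegativity of the gap
bounds it from above by a smaller power. -/
theorem not_global_of_subcritical (E F : RadialEqn)
    (hsub : (E.s + 1) * E.crit < (E.κ + 1) * E.A) :
    ¬ ∃ u v, ∀ L, 0 ≤ L → IsSol E F 1 0 L u v := by
  rintro ⟨u, v, h⟩
  have hs0 : 0 < E.s + 1 := by linarith [E.s_nonneg]
  have hκ0 := E.κ_pos
  have hκ1 : 0 < E.κ + 1 := by linarith
  have hcoef : 0 < E.A / (E.s + 1) - E.crit / (E.κ + 1) := by
    rw [sub_pos, div_lt_div_iff₀ hκ1 hs0]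
    linarith
  have hmono : ∀ L, 0 ≤ L → StrictMonoOn (pohozaev E u v) (Icc 0 L) := fun L hL => by
    refine strictMonoOn_of_hasDerivWithinAt_pos (convex_Icc 0 L) (continuousOn_pohozaev (h L hL))
      (fun r hr => (hasDerivAt_pohozaev (h L hL)
        (by rwa [interior_Icc] at hr)).hasDerivWithinAt) fun r hr => ?_
    rw [interior_Icc] at hr
    exact mul_pos hcoef (mul_pos (Real.rpow_pos_of_pos hr.1 _)
      (Real.rpow_pos_of_pos ((h L hL).pos_u r (Ioo_subset_Icc_self hr)) _))
  set P₁ := pohozaev E u v 1 with hP₁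
  have hP₁0 : 0 < P₁ := by
    have := hmono 1 zero_le_one ⟨le_rfl, zero_le_one⟩ ⟨zero_le_one, le_rfl⟩ zero_lt_one
    rwa [pohozaev_zero] at this
  have hslope : ∀ r, 0 ≤ r → r ^ (E.α + 1) * E.mean u v r ^ E.κ ≤ E.crit * u r := fun r hr => by
    have := gap_nonneg_of_global h zero_le_one hr
    rw [RadialEqn.gap, RadialEqn.slope, one_mul] at this
    linarith
  have hlow : ∀ r, 1 ≤ r → P₁ * (E.s + 1) ≤ r ^ E.A * u r ^ (E.s + 1) := fun r hr => by
    have hr0 : 0 < r := by linarith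
    have hs := h r hr0.le
    have hm := hs.mean_pos ⟨hr0.le, le_rfl⟩
    have h1 : P₁ ≤ pohozaev E u v r :=
      (hmono r hr0.le).monotoneOn ⟨zero_le_one, hr⟩ ⟨hr0.le, le_rfl⟩ hr
    have h2 : r ^ (E.α + 1) * E.mean u v r ^ (E.κ + 1) / (E.κ + 1)
        ≤ E.crit / (E.κ + 1) * (E.mean u v r * u r) := by
      rw [Real.rpow_add_one hm.ne', div_mul_eq_mul_div, div_le_div_iff_of_pos_right hκ1]
      have := mul_le_mul_of_nonneg_right (hslope r hr0.le) hm.le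
      linarith
    have h3 : pohozaev E u v r ≤ r ^ E.A * (u r ^ (E.s + 1) / (E.s + 1)) :=
      mul_le_mul_of_nonneg_left (by linarith) (Real.rpow_nonneg hr0.le _)
    have h4 := h1.trans h3
    rwa [← mul_div_assoc, le_div_iff₀ hs0] at h4
  -- The exponent `e` replaces `s κ - 1` when the latter is negative; this is harmless as `u ≤ 1`.
  set e := max (E.s * E.κ - 1) 0 with he
  have he0 : 0 ≤ e := le_max_right _ _
  have hup : ∀ r, 1 ≤ r → r ^ (E.α + 1) * u r ^ e ≤ E.crit * E.A ^ E.κ := fun r hr => by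
    have hr0 : 0 < r := by linarith
    have hs := h r hr0.le
    have hrr : r ∈ Icc 0 r := ⟨hr0.le, le_rfl⟩
    have hu := hs.pos_u r hrr
    have hmean : u r ^ E.s / E.A ≤ E.mean u v r :=
      le_radialMean E.A_pos hr0.le (E.continuousOn_force hs.cont_u hs.cont_v) fun x hx => by
        rw [RadialEqn.force, hs.symm.eq_one hx, Real.one_rpow, mul_one]
        exact Real.rpow_le_rpow hu.le (hs.antitoneOn zero_le_one hx hrr hx.2) E.s_nonneg
    have h1 : (u r ^ E.s / E.A) ^ E.κ ≤ E.mean u v r ^ E.κ :=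
      Real.rpow_le_rpow (div_nonneg (Real.rpow_nonneg hu.le _) E.A_pos.le) hmean hκ0.le
    rw [Real.div_rpow (Real.rpow_nonneg hu.le _) E.A_pos.le, ← Real.rpow_mul hu.le,
      div_le_iff₀ (Real.rpow_pos_of_pos E.A_pos _)] at h1
    have h2 : u r ^ e ≤ u r ^ (E.s * E.κ - 1) :=
      Real.rpow_le_rpow_of_exponent_ge hu (hs.le_one zero_le_one hrr) (le_max_left _ _)
    rw [Real.rpow_sub_one hu.ne', le_div_iff₀ hu] at h2
    have hA := Real.rpow_pos_of_pos E.A_pos E.κ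
    have hrα := Real.rpow_pos_of_pos hr0 (E.α + 1)
    have h3 : r ^ (E.α + 1) * (u r ^ e * u r) ≤ E.crit * u r * E.A ^ E.κ :=
      calc _ ≤ r ^ (E.α + 1) * (E.mean u v r ^ E.κ * E.A ^ E.κ) :=
            mul_le_mul_of_nonneg_left (h2.trans h1) hrα.le
        _ = r ^ (E.α + 1) * E.mean u v r ^ E.κ * E.A ^ E.κ := by ring
        _ ≤ _ := mul_le_mul_of_nonneg_right (hslope r hr0.le) hA.le
    refine le_of_mul_le_mul_right ?_ hu
    linarith
  set γ := E.α + 1 - E.A * (e / (E.s + 1)) with hγ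
  have hγ0 : 0 < γ := by
    have hα := E.α_add_one_pos
    rw [hγ, sub_pos, ← mul_div_assoc, div_lt_iff₀ hs0]
    rcases le_total (E.s * E.κ - 1) 0 with h0 | h0
    · rw [he, max_eq_right h0, mul_zero]
      exact mul_pos hα hs0
    · rw [he, max_eq_left h0]
      unfold RadialEqn.crit at hsub
      linarith
  set c₁ := (P₁ * (E.s + 1)) ^ (e / (E.s + 1)) with hc₁
  have hc₁0 : 0 < c₁ := Real.rpow_pos_of_pos (mul_pos hP₁0 hs0) _
  have hbound : ∀ r, 1 ≤ r → r ^ γ * c₁ ≤ E.crit * E.A ^ E.κ := fun r hr => by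
    have hr0 : 0 < r := by linarith
    have hu := (h r hr0.le).pos_u r ⟨hr0.le, le_rfl⟩
    have h1 := Real.rpow_le_rpow (mul_pos hP₁0 hs0).le (hlow r hr) (div_nonneg he0 hs0.le)
    rw [Real.mul_rpow (Real.rpow_nonneg hr0.le _) (Real.rpow_nonneg hu.le _),
      ← Real.rpow_mul hr0.le, ← Real.rpow_mul hu.le, mul_div_cancel₀ _ hs0.ne'] at h1
    refine le_trans ?_ (hup r hr)
    calc r ^ γ * c₁ ≤ r ^ γ * (r ^ (E.A * (e / (E.s + 1))) * u r ^ e) :=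
          mul_le_mul_of_nonneg_left h1 (Real.rpow_nonneg hr0.le _)
      _ = r ^ (E.α + 1) * u r ^ e := by
          rw [← mul_assoc, ← Real.rpow_add hr0, hγ, sub_add_cancel]
  obtain ⟨r, hr1, hr2⟩ := (((tendsto_rpow_atTop hγ0).eventually
    (eventually_gt_atTop (E.crit * E.A ^ E.κ / c₁))).and (eventually_ge_atTop 1)).exists
  rw [div_lt_iff₀ hc₁0] at hr1
  exact hr1.not_ge (hbound r hr2)

end Pohozaev

/-! ### From the normalized system to the radial equations -/

section Regularity

variable {E F : RadialEqn} {c d L : ℝ} {u v : ℝ → ℝ}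

lemma IsSol.contDiffOn (h : IsSol E F c d L u v) : ContDiffOn ℝ 2 u (Ioo 0 L) := by
  set M : ℝ → ℝ := fun x => ∫ σ in (0 : ℝ)..x, σ ^ (E.A - 1) * E.force u v σ with hM_def
  have hne : ∀ x ∈ Ioo 0 L, x ≠ 0 := fun x hx => hx.1.ne'
  have hMne : ∀ x ∈ Ioo 0 L, M x ≠ 0 := fun x hx => (h.mass_pos (Ioo_subset_Ioc_self hx)).ne'
  have hM : ContDiffOn ℝ 1 M (Ioo 0 L) := by
    rw [show (1 : WithTop ℕ∞) = 0 + 1 by norm_num, contDiffOn_succ_iff_deriv_of_isOpen isOpen_Ioo]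
    refine ⟨fun x hx => (h.hasDerivAt_mass hx).differentiableAt.differentiableWithinAt,
      by simp, ?_⟩
    rw [contDiffOn_zero]
    have hf := (E.continuousOn_force h.cont_u h.cont_v).mono Ioo_subset_Icc_self
    have hpow : ContinuousOn (fun x : ℝ => x ^ (E.A - 1)) (Ioo 0 L) :=
      continuousOn_id.rpow_const fun x hx => Or.inl (hne x hx)
    exact (hpow.mul hf).congr fun x hx => (h.hasDerivAt_mass hx).deriv
  rw [show (2 : WithTop ℕ∞) = 1 + 1 by norm_num, contDiffOn_succ_iff_deriv_of_isOpen isOpen_Ioo]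
  refine ⟨fun x hx => (h.hasDerivAt hx).differentiableAt.differentiableWithinAt, by simp, ?_⟩
  have hd : ContDiffOn ℝ 1 (fun x => -(c * (x ^ (-E.crit) * M x ^ E.κ) / x)) (Ioo 0 L) :=
    ((contDiffOn_const.mul ((contDiffOn_id.rpow_const_of_ne hne).mul
      (hM.rpow_const_of_ne hMne))).div contDiffOn_id hne).neg
  refine hd.congr fun x hx => ?_
  rw [(h.hasDerivAt_slope_div hx).deriv, h.slope_eq (Ioo_subset_Ioc_self hx)]

end Regularity

/-- The normalized form of the equation `-Δ_p u = |x| ^ a u ^ s v ^ δ` in `ℝ ^ N`. -/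
noncomputable def laplaceEqn (N : ℕ) (p a s δ : ℝ) (hp : 1 < p) (hpN : p < N) (hpa : 0 < p + a)
    (hs : 0 ≤ s) (hδ : 0 ≤ δ) : RadialEqn where
  A := N + a
  α := (1 + a) / (p - 1)
  κ := 1 / (p - 1)
  s := s
  δ := δ
  A_pos := by linarith
  α_gt := by rw [lt_div_iff₀ (by linarith)]; linarith
  κ_pos := one_div_pos.2 (by linarith)
  s_nonneg := hs
  δ_nonneg := hδ
  lt_mul := by
    have : 0 < p - 1 := by linarith
    rw [div_add_one this.ne', one_div_mul_eq_div, div_lt_div_iff_of_pos_right this]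
    linarith

section Transfer

variable {N : ℕ} {p a s δ : ℝ} {hp : 1 < p} {hpN : p < N} {hpa : 0 < p + a} {hs : 0 ≤ s}
  {hδ : 0 ≤ δ} {F : RadialEqn} {c d L ℓ u₀ v₀ r : ℝ} {U V : ℝ → ℝ}

lemma crit_laplaceEqn : (laplaceEqn N p a s δ hp hpN hpa hs hδ).crit = (N - p) / (p - 1) := by
  have : p - 1 ≠ 0 := by linarith
  simp only [RadialEqn.crit, laplaceEqn]
  field_simp
  ring

lemma subcritical_laplaceEqn (h : s < (N * (p - 1) + p + p * a) / (N - p)) :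
    ((laplaceEqn N p a s δ hp hpN hpa hs hδ).s + 1) *
        (laplaceEqn N p a s δ hp hpN hpa hs hδ).crit
      < ((laplaceEqn N p a s δ hp hpN hpa hs hδ).κ + 1) *
        (laplaceEqn N p a s δ hp hpN hpa hs hδ).A := by
  have h1 : 0 < p - 1 := by linarith
  rw [crit_laplaceEqn]
  simp only [laplaceEqn]
  rw [lt_div_iff₀ (by linarith)] at h
  rw [← mul_div_assoc, div_add_one h1.ne', div_mul_eq_mul_div, div_lt_div_iff_of_pos_right h1]
  linarith

lemma hasDerivAt_scaled {E : RadialEqn} (h : IsSol E F c d L U V) (hℓ : 0 < ℓ)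
    (hr : r / ℓ ∈ Ioo 0 L) :
    HasDerivAt (fun x => u₀ * U (x / ℓ)) (-(u₀ * E.slope c U V (r / ℓ) / r)) r := by
  have hr0 : r ≠ 0 := fun h0 => by rw [h0, zero_div] at hr; exact hr.1.false
  have h1 := (h.hasDerivAt_slope_div hr).comp r ((hasDerivAt_id r).div_const ℓ)
  refine (h1.const_mul u₀).congr_deriv ?_
  field_simp

lemma phaseSlope_scaled {E : RadialEqn} (h : IsSol E F c d L U V) (hℓ : 0 < ℓ) (hu₀ : 0 < u₀)
    {t : ℝ} (hr : Real.exp t / ℓ ∈ Ioo 0 L) :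
    phaseSlope (fun x => u₀ * U (x / ℓ)) t
      = E.slope c U V (Real.exp t / ℓ) / U (Real.exp t / ℓ) := by
  have hU := (h.pos_u _ (Ioo_subset_Icc_self hr)).ne'
  have ht := (Real.exp_pos t).ne'
  rw [phaseSlope, (hasDerivAt_scaled h hℓ hr).deriv]
  field_simp

lemma scaled_contDiffAt {E : RadialEqn} (h : IsSol E F c d L U V) (hr : r / ℓ ∈ Ioo 0 L) :
    ContDiffAt ℝ 2 (fun x => u₀ * U (x / ℓ)) r := by
  have h1 : ContDiffAt ℝ 2 U (r / ℓ) := h.contDiffOn.contDiffAt (Ioo_mem_nhds hr.1 hr.2)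
  exact contDiffAt_const.mul (h1.comp r (contDiffAt_id.div_const ℓ))

/-- Under the balance condition between the amplitudes `u₀`, `v₀`, the length `ℓ` and the strength `c`,
the rescaled unknown satisfies the radial `p`-Laplace equation. -/
lemma hasDerivAt_radialFlux_scaled
    (h : IsSol (laplaceEqn N p a s δ hp hpN hpa hs hδ) F c d L U V) (hc : 0 < c) (hℓ : 0 < ℓ)
    (hu₀ : 0 < u₀) (hv₀ : 0 < v₀)
    (hbal : (u₀ * c / ℓ) ^ (p - 1) = ℓ ^ (1 + a) * (u₀ ^ s * v₀ ^ δ)) (hr : r / ℓ ∈ Ioo 0 L) :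
    HasDerivAt (radialFlux N p (fun x => u₀ * U (x / ℓ)))
      (-(r ^ ((N : ℝ) - 1) * (r ^ a * (u₀ * U (r / ℓ)) ^ s * (v₀ * V (r / ℓ)) ^ δ))) r := by
  set E := laplaceEqn N p a s δ hp hpN hpa hs hδ with hE
  set M : ℝ → ℝ := fun x => ∫ σ in (0 : ℝ)..x, σ ^ (E.A - 1) * E.force U V σ with hM_def
  have hp1 : 0 < p - 1 := by linarith
  -- The flux is a constant multiple of the mass of the reaction term in the ball of radius `x / ℓ`.
  have hflux : ∀ x, x / ℓ ∈ Ioo 0 L → radialFlux N p (fun x => u₀ * U (x / ℓ)) x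
      = -((u₀ * c / ℓ) ^ (p - 1) * ℓ ^ ((N : ℝ) - 1) * M (x / ℓ)) := by
    intro x hx
    have hρ : 0 < x / ℓ := hx.1
    have hm := h.mean_pos (Ioo_subset_Icc_self hx)
    set ρ := x / ℓ with hρ_def
    have hxρ : x = ℓ * ρ := by rw [hρ_def]; field_simp
    have hD : deriv (fun x => u₀ * U (x / ℓ)) x
        = -((u₀ * c / ℓ) * (ρ ^ E.α * E.mean U V ρ ^ E.κ)) := by
      rw [(hasDerivAt_scaled h hℓ hx).deriv, RadialEqn.slope, ← hρ_def, hxρ,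
        Real.rpow_add_one hρ.ne']
      field_simp
    set w := (u₀ * c / ℓ) * (ρ ^ E.α * E.mean U V ρ ^ E.κ) with hw
    have hk : 0 < u₀ * c / ℓ := by positivity
    have hρα := Real.rpow_pos_of_pos hρ E.α
    have hmκ := Real.rpow_pos_of_pos hm E.κ
    have hw0 : 0 < w := by positivity
    have hpow : |(-w)| ^ (p - 2) * -w = -(w ^ (p - 1)) := by
      rw [abs_neg, abs_of_pos hw0, mul_neg, ← Real.rpow_add_one hw0.ne']
      congr 2
      ring
    have eα : E.α * (p - 1) = 1 + a := by
      rw [hE]; simp only [laplaceEqn]; field_simp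
    have eκ : E.κ * (p - 1) = 1 := by
      rw [hE]; simp only [laplaceEqn]; field_simp
    have hwp : w ^ (p - 1) = (u₀ * c / ℓ) ^ (p - 1) * (ρ ^ (1 + a) * E.mean U V ρ) := by
      rw [hw, Real.mul_rpow hk.le (mul_pos hρα hmκ).le, Real.mul_rpow hρα.le hmκ.le,
        ← Real.rpow_mul hρ.le, ← Real.rpow_mul hm.le, eα, eκ, Real.rpow_one]
    have hMρ : M ρ = ρ ^ E.A * E.mean U V ρ := (rpow_mul_radialMean hρ).symm
    have eA : ρ ^ E.A = ρ ^ ((N : ℝ) - 1) * ρ ^ (1 + a) := by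
      rw [← Real.rpow_add hρ]
      congr 1
      rw [hE]
      simp only [laplaceEqn]
      ring
    rw [radialFlux, hD, hpow, hwp, hMρ, eA, hxρ, Real.mul_rpow hℓ.le hρ.le]
    ring
  have hρ : 0 < r / ℓ := hr.1
  have hU := h.pos_u _ (Ioo_subset_Icc_self hr)
  have hV := h.pos_v _ (Ioo_subset_Icc_self hr)
  have hev : radialFlux N p (fun x => u₀ * U (x / ℓ)) =ᶠ[𝓝 r]
      fun x => -((u₀ * c / ℓ) ^ (p - 1) * ℓ ^ ((N : ℝ) - 1) * M (x / ℓ)) := by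
    have hcont : ContinuousAt (fun x : ℝ => x / ℓ) r := by fun_prop
    filter_upwards [hcont.eventually (Ioo_mem_nhds hr.1 hr.2)] with x hx
    exact hflux x hx
  have hM := (h.hasDerivAt_mass hr).comp r ((hasDerivAt_id r).div_const ℓ)
  refine HasDerivAt.congr_of_eventuallyEq ?_ hev
  refine (hM.const_mul ((u₀ * c / ℓ) ^ (p - 1) * ℓ ^ ((N : ℝ) - 1))).neg.congr_deriv ?_
  set ρ := r / ℓ with hρ_def
  have hrρ : r = ℓ * ρ := by rw [hρ_def]; field_simp
  have hforce : E.force U V ρ = U ρ ^ s * V ρ ^ δ := rfl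
  have eA : ρ ^ (E.A - 1) = ρ ^ ((N : ℝ) - 1) * ρ ^ a := by
    rw [← Real.rpow_add hρ]
    congr 1
    rw [hE]
    simp only [laplaceEqn]
    ring
  rw [hbal, hforce, eA, hrρ, Real.mul_rpow hℓ.le hρ.le, Real.mul_rpow hℓ.le hρ.le,
    Real.mul_rpow hu₀.le hU.le, Real.mul_rpow hv₀.le hV.le, Real.rpow_add hℓ, Real.rpow_one]
  field_simp

end Transfer

/-- The balance conditions are a linear system for `log u₀` and `log v₀`, whose determinant is nonzero. -/
lemma exists_amplitudes {p q a b s m δ μ c d ℓ : ℝ}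
    (hD : 0 < δ * μ - (p - 1 - s) * (q - 1 - m)) (hc : 0 < c) (hd : 0 < d) (hℓ : 0 < ℓ) :
    ∃ u₀ v₀, 0 < u₀ ∧ 0 < v₀ ∧ (u₀ * c / ℓ) ^ (p - 1) = ℓ ^ (1 + a) * (u₀ ^ s * v₀ ^ δ) ∧
      (v₀ * d / ℓ) ^ (q - 1) = ℓ ^ (1 + b) * (v₀ ^ m * u₀ ^ μ) := by
  have key : ∀ {x y c p a s δ : ℝ}, 0 < c →
      (p - 1) * (x + Real.log c - Real.log ℓ) = (1 + a) * Real.log ℓ + (s * x + δ * y) →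
      (Real.exp x * c / ℓ) ^ (p - 1) = ℓ ^ (1 + a) * (Real.exp x ^ s * Real.exp y ^ δ) := by
    intro x y c p a s δ hc h
    have hx := Real.exp_pos x
    rw [← Real.exp_mul, ← Real.exp_mul, Real.rpow_def_of_pos (by positivity),
      Real.rpow_def_of_pos hℓ, ← Real.exp_add, ← Real.exp_add, Real.log_div (by positivity) hℓ.ne',
      Real.log_mul hx.ne' hc.ne', Real.log_exp]
    congr 1
    linarith
  set Δ := δ * μ - (p - 1 - s) * (q - 1 - m) with hΔ
  set h₁ := (1 + a) * Real.log ℓ - (p - 1) * (Real.log c - Real.log ℓ) with hh₁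
  set h₂ := (1 + b) * Real.log ℓ - (q - 1) * (Real.log d - Real.log ℓ) with hh₂
  set x := -(h₁ * (q - 1 - m) + δ * h₂) / Δ with hx
  set y := -((p - 1 - s) * h₂ + μ * h₁) / Δ with hy
  have e₁ : (p - 1 - s) * x - δ * y = h₁ := by
    rw [hx, hy]
    field_simp
    rw [hΔ]
    ring
  have e₂ : (q - 1 - m) * y - μ * x = h₂ := by
    rw [hx, hy]
    field_simp
    rw [hΔ]
    ring
  refine ⟨Real.exp x, Real.exp y, Real.exp_pos _, Real.exp_pos _, key hc ?_, key hd ?_⟩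
  · rw [hh₁] at e₁; linarith
  · rw [hh₂] at e₂; linarith

section System

variable {N : ℕ} {p q a b s m δ μ : ℝ} {hp : 1 < p} {hpN : p < N} {hpa : 0 < p + a} {hs : 0 ≤ s}
  {hδ : 0 ≤ δ} {hq : 1 < q} {hqN : q < N} {hqb : 0 < q + b} {hm : 0 ≤ m} {hμ : 0 ≤ μ}
  {c d ℓ u₀ v₀ : ℝ} {U V : ℝ → ℝ}

lemma isPositiveRadialSolution_scaled {I : Set ℝ} (hc : 0 < c) (hd : 0 < d) (hℓ : 0 < ℓ)
    (hu₀ : 0 < u₀) (hv₀ : 0 < v₀)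
    (hbal₁ : (u₀ * c / ℓ) ^ (p - 1) = ℓ ^ (1 + a) * (u₀ ^ s * v₀ ^ δ))
    (hbal₂ : (v₀ * d / ℓ) ^ (q - 1) = ℓ ^ (1 + b) * (v₀ ^ m * u₀ ^ μ))
    (hI : ∀ r ∈ I, ∃ L, r / ℓ ∈ Ioo 0 L ∧ IsSol (laplaceEqn N p a s δ hp hpN hpa hs hδ)
      (laplaceEqn N q b m μ hq hqN hqb hm hμ) c d L U V) :
    IsPositiveRadialSolution N p q a b s m δ μ I (fun x => u₀ * U (x / ℓ))
      (fun x => v₀ * V (x / ℓ)) where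
  u_pos := fun r hr => by
    obtain ⟨L, hL, h⟩ := hI r hr
    exact mul_pos hu₀ (h.pos_u _ (Ioo_subset_Icc_self hL))
  v_pos := fun r hr => by
    obtain ⟨L, hL, h⟩ := hI r hr
    exact mul_pos hv₀ (h.pos_v _ (Ioo_subset_Icc_self hL))
  u_contDiffOn := fun r hr => by
    obtain ⟨L, hL, h⟩ := hI r hr
    exact (scaled_contDiffAt h hL).contDiffWithinAt
  v_contDiffOn := fun r hr => by
    obtain ⟨L, hL, h⟩ := hI r hr
    exact (scaled_contDiffAt h.symm hL).contDiffWithinAt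
  u_equation := fun r hr => by
    obtain ⟨L, hL, h⟩ := hI r hr
    exact hasDerivAt_radialFlux_scaled h hc hℓ hu₀ hv₀ hbal₁ hL
  v_equation := fun r hr => by
    obtain ⟨L, hL, h⟩ := hI r hr
    convert hasDerivAt_radialFlux_scaled h.symm hd hℓ hv₀ hu₀ hbal₂ hL using 3
    ring

end System

section Continuity

variable {E F : RadialEqn} {c d R ℓ k : ℝ} {U V : ℝ → ℝ}

lemma continuousOn_scaled_of_global (h : ∀ L, 0 ≤ L → IsSol E F c d L U V) (hℓ : 0 < ℓ) :
    ContinuousOn (fun x => k * U (x / ℓ)) (Ici 0) := by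
  have hU : ContinuousOn U (Ici 0) := fun x hx => by
    have hx0 : 0 ≤ x := hx
    refine ((h (x + 1) (by linarith)).cont_u x ⟨hx, by linarith⟩).mono_of_mem_nhdsWithin ?_
    filter_upwards [self_mem_nhdsWithin, mem_nhdsWithin_of_mem_nhds
      (Iio_mem_nhds (show x < x + 1 by linarith))] with y hy hy'
    exact ⟨hy, le_of_lt hy'⟩
  exact continuousOn_const.mul (hU.comp (by fun_prop) fun x hx => div_nonneg hx hℓ.le)

lemma IsMaximalSol.continuousOn (h : IsMaximalSol E F c d R U V) : ContinuousOn U (Ico 0 R) := by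
  intro x hx
  have h1 : (x + R) / 2 < R := by linarith [hx.2]
  have h2 : x < (x + R) / 2 := by linarith [hx.2]
  refine ((h.isSol _ ⟨hx.1.trans h2.le, h1⟩).cont_u x ⟨hx.1, h2.le⟩).mono_of_mem_nhdsWithin ?_
  filter_upwards [self_mem_nhdsWithin, mem_nhdsWithin_of_mem_nhds (Iio_mem_nhds h2)] with y hy hy'
  exact ⟨hy.1, le_of_lt hy'⟩

lemma IsMaximalSol.continuousOn_indicator (h : IsMaximalSol E F c d R U V)
    (hU : Tendsto U (𝓝[<] R) (𝓝 0)) : ContinuousOn ((Iio R).indicator U) (Icc 0 R) := by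
  have heq : EqOn ((Iio R).indicator U) U (Iio R) := fun x hx => indicator_of_mem hx U
  intro x hx
  rw [← Ico_insert_right h.R_pos.le]
  rcases hx.2.eq_or_lt with rfl | hxR
  · rw [continuousWithinAt_insert_self, ContinuousWithinAt,
      indicator_of_notMem (by simp : x ∉ Iio x)]
    refine (hU.mono_left (nhdsWithin_mono _ fun y hy => hy.2)).congr' ?_
    filter_upwards [self_mem_nhdsWithin] with y hy
    exact (heq hy.2).symm
  · rw [continuousWithinAt_insert]
    exact (h.continuousOn.congr (heq.mono fun y hy => hy.2)) x ⟨hx.1, hxR⟩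

lemma IsMaximalSol.indicator (h : IsMaximalSol E F c d R U V) :
    IsMaximalSol E F c d R ((Iio R).indicator U) ((Iio R).indicator V) :=
  ⟨h.R_pos, fun L hL => (h.isSol L hL).congr
    (fun x hx => indicator_of_mem (show x ∈ Iio R from hx.2.trans_lt hL.2) U)
    (fun x hx => indicator_of_mem (show x ∈ Iio R from hx.2.trans_lt hL.2) V), h.lt_of_isSol⟩

end Continuity

theorem theorem1p1 (N : ℕ) (p q a b s m δ μ : ℝ)
    (hp : 1 < p) (hpN : p < N) (hq : 1 < q) (hqN : q < N)
    (hpa : 0 < p + a) (hqb : 0 < q + b)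
    (hδ : 0 < δ) (hμ : 0 < μ) (hs : 0 ≤ s) (hm : 0 ≤ m)
    (hD : 0 < δ * μ - (p - 1 - s) * (q - 1 - m))
    (hs_sub : s < (N * (p - 1) + p + p * a) / (N - p))
    (hm_sub : m < (N * (q - 1) + q + q * b) / (N - q))
    (hGS : ¬ ∃ u v : ℝ → ℝ, IsRadialGroundState N p q a b s m δ μ u v) :
    (∃ (R : ℝ) (u v : ℝ → ℝ), IsRegularRadialSolution N p q a b s m δ μ R u v ∧
      ∃ T : ℝ, 0 < T ∧ Real.exp T < R ∧
        phaseSlope u T = (N - p) / (p - 1) ∧ phaseSlope v T = (N - q) / (q - 1) ∧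
        ∀ t < T, (0 < phaseSlope u t ∧ phaseSlope u t < (N - p) / (p - 1)) ∧
          (0 < phaseSlope v t ∧ phaseSlope v t < (N - q) / (q - 1))) ∧
    (∃ (R : ℝ) (u v : ℝ → ℝ), IsRadialDirichletSolution N p q a b s m δ μ R u v) := by
  set E := laplaceEqn N p a s δ hp hpN hpa hs hδ.le with hE
  set F := laplaceEqn N q b m μ hq hqN hqb hm hμ.le with hF
  have hno : ∀ θ ∈ Icc (0 : ℝ) 1, ¬ ∃ u v, ∀ L, 0 ≤ L → IsSol E F |1 - θ| |θ| L u v := by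
    rintro θ hθ ⟨U, V, h⟩
    rcases hθ.1.eq_or_lt with rfl | h0
    · rw [sub_zero, abs_one, abs_zero] at h
      exact not_global_of_subcritical E F (subcritical_laplaceEqn hs_sub) ⟨U, V, h⟩
    rcases hθ.2.eq_or_lt with rfl | h1
    · rw [sub_self, abs_one, abs_zero] at h
      exact not_global_of_subcritical F E (subcritical_laplaceEqn hm_sub)
        ⟨V, U, fun L hL => (h L hL).symm⟩
    have hc : 0 < |1 - θ| := abs_pos.2 (by linarith)
    have hd : 0 < |θ| := abs_pos.2 h0.ne'
    obtain ⟨u₀, v₀, hu₀, hv₀, hb₁, hb₂⟩ :=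
      exists_amplitudes (a := a) (b := b) hD hc hd one_pos
    refine hGS ⟨_, _, isPositiveRadialSolution_scaled hc hd one_pos hu₀ hv₀ hb₁ hb₂
      fun r hr => ⟨r + 1, ?_, h (r + 1) ?_⟩, continuousOn_scaled_of_global h one_pos,
      continuousOn_scaled_of_global (fun L hL => (h L hL).symm) one_pos⟩
    · have hr0 : 0 < r := hr
      rw [div_one]
      exact ⟨hr0, by linarith⟩
    · have hr0 : 0 < r := hr
      linarith
  constructor
  · obtain ⟨c, d, R, U, V, hc, hd, h, r₁, hr₁, hgU, hgV⟩ := exists_simultaneous_crossing E F hno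
    -- With this scaling the common crossing sits at `T = 1`.
    set ℓ := Real.exp 1 / r₁ with hℓ_def
    have hℓ : 0 < ℓ := div_pos (Real.exp_pos 1) hr₁.1
    have hℓr : Real.exp 1 / ℓ = r₁ := by
      have := hr₁.1.ne'
      rw [hℓ_def]; field_simp
    obtain ⟨u₀, v₀, hu₀, hv₀, hb₁, hb₂⟩ := exists_amplitudes (a := a) (b := b) hD hc hd hℓ
    have hmaps : MapsTo (fun x => x / ℓ) (Ico 0 (ℓ * R)) (Ico 0 R) := fun x hx =>
      ⟨div_nonneg hx.1 hℓ.le, (div_lt_iff₀' hℓ).2 hx.2⟩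
    have hmid : ∀ {ρ}, ρ ∈ Ioo 0 R → ρ ∈ Ioo 0 ((ρ + R) / 2) ∧ IsSol E F c d ((ρ + R) / 2) U V :=
      fun {ρ} hρ => ⟨⟨hρ.1, by linarith [hρ.2]⟩,
        h.isSol _ ⟨by linarith [hρ.1, hρ.2], by linarith [hρ.2]⟩⟩
    have hphase : ∀ {E F : RadialEqn} {c d k : ℝ} {U V : ℝ → ℝ}, 0 < c → 0 < k →
        IsMaximalSol E F c d R U V → E.gap c U V r₁ = 0 →
        phaseSlope (fun x => k * U (x / ℓ)) 1 = E.crit ∧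
        ∀ t < 1, 0 < phaseSlope (fun x => k * U (x / ℓ)) t ∧
          phaseSlope (fun x => k * U (x / ℓ)) t < E.crit := by
      intro E F c d k U V hc hk h hg
      have hL : (r₁ + R) / 2 ∈ Ico 0 R := ⟨by linarith [hr₁.1, hr₁.2], by linarith [hr₁.2]⟩
      have hs := h.isSol _ hL
      have hr₁L : r₁ ∈ Ioo 0 ((r₁ + R) / 2) := ⟨hr₁.1, by linarith [hr₁.2]⟩
      constructor
      · rw [phaseSlope_scaled hs hℓ hk (by rwa [hℓr]), hℓr,
          div_eq_iff (hs.pos_u _ (Ioo_subset_Icc_self hr₁L)).ne']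
        rw [RadialEqn.gap] at hg
        linarith
      · intro t ht
        have hlt : Real.exp t / ℓ < r₁ := by
          rw [← hℓr]
          exact div_lt_div_of_pos_right (Real.exp_lt_exp.2 ht) hℓ
        have hρ : Real.exp t / ℓ ∈ Ioo 0 ((r₁ + R) / 2) :=
          ⟨div_pos (Real.exp_pos t) hℓ, hlt.trans hr₁L.2⟩
        have hU := hs.pos_u _ (Ioo_subset_Icc_self hρ)
        have hgap := hs.strictAntiOn_gap hc (Ioo_subset_Icc_self hρ) (Ioo_subset_Icc_self hr₁L) hlt
        rw [hg, RadialEqn.gap] at hgap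
        rw [phaseSlope_scaled hs hℓ hk hρ]
        exact ⟨div_pos (hs.slope_pos hc (Ioo_subset_Ioc_self hρ)) hU,
          (div_lt_iff₀ hU).2 (by linarith)⟩
    have hX := hphase hc hu₀ h hgU
    have hY := hphase hd hv₀ h.symm hgV
    rw [hE, crit_laplaceEqn] at hX
    rw [hF, crit_laplaceEqn] at hY
    refine ⟨ℓ * R, fun x => u₀ * U (x / ℓ), fun x => v₀ * V (x / ℓ), ⟨?_, ?_, ?_⟩, 1, one_pos, ?_,
      hX.1, hY.1, fun t ht => ⟨hX.2 t ht, hY.2 t ht⟩⟩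
    · exact isPositiveRadialSolution_scaled hc hd hℓ hu₀ hv₀ hb₁ hb₂ fun r hr =>
        ⟨_, hmid ⟨div_pos hr.1 hℓ, (div_lt_iff₀' hℓ).2 hr.2⟩⟩
    · exact continuousOn_const.mul (h.continuousOn.comp (by fun_prop) hmaps)
    · exact continuousOn_const.mul (h.symm.continuousOn.comp (by fun_prop) hmaps)
    · exact (div_lt_iff₀' hℓ).1 (hℓr ▸ hr₁.2)
  · obtain ⟨c, d, R, U, V, hc, hd, h, hU, hV⟩ := exists_simultaneous_zero E F hno
    obtain ⟨u₀, v₀, hu₀, hv₀, hb₁, hb₂⟩ :=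
      exists_amplitudes (a := a) (b := b) hD hc hd one_pos
    have hind := h.indicator
    have hcont : ∀ {k : ℝ} {W : ℝ → ℝ}, ContinuousOn ((Iio R).indicator W) (Icc 0 R) →
        ContinuousOn (fun x => k * (Iio R).indicator W (x / 1)) (Icc 0 R) := fun hW => by
      simp only [div_one]
      exact continuousOn_const.mul hW
    have hbd : ∀ {k : ℝ} {W : ℝ → ℝ}, k * (Iio R).indicator W (R / 1) = 0 := by simp
    refine ⟨R, _, _, h.R_pos, isPositiveRadialSolution_scaled hc hd one_pos hu₀ hv₀ hb₁ hb₂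
      fun r hr => ⟨(r + R) / 2, ?_, hind.isSol _ ?_⟩, hcont (h.continuousOn_indicator hU),
      hcont (h.symm.continuousOn_indicator hV), hbd, hbd⟩
    · rw [div_one]
      exact ⟨hr.1, by linarith [hr.2]⟩
    · exact ⟨by linarith [hr.1, hr.2], by linarith [hr.2]⟩
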